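/- Fix $0<\beta\le \tfrac12$ and let $\gamma(t)=|t|$ for $|t|>\beta$ and $\gamma(t)=\frac{t^2}{2\beta}+\frac{\beta}{2}$ for $|t|\le\beta$. There are constants $C,c,\delta>0$, depending only on $\beta$, with the following property. Let $n,m$ be natural numbers with $m\ge Cn$, let $x\in\mathbb R^n$ be nonzero, and let $a_1,\dots,a_m$ be i.i.d. random vectors with $a_i\sim N(0,I_n)$. Let $$F(z)=\frac1{2m}\sum_{i=1}^m\Bigl(\gamma\Bigl(\frac{|a_i^\top z|}{|a_i^\top x|}\Bigr)-1\Bigr)^2|a_i^\top x|^2,\qquad z\in\mathbb R^n,$$ where the $i$-th summand is read as $|a_i^\top z|^2$ if $a_i^\top x=0$. Then, with probability at least $1-c\exp(-\delta m)$, the function $F$ has no spurious local minima, that is, all of the following hold: 1. the local minimizers of $F$ are exactly $x$ and $-x$, and these are exactly the global minimizers of $F$; 2. every other critical point $z$ of $F$ (i.e. $\nabla F(z)=0$, $z\neq\pm x$) is not a local minimizer, and there is a direction $v\ne0$ such that the second order directional derivative $D_v^2F(z)$ exists and is negative; moreover, if $z\ne 0$, then $z$ is not a local maximizer either, so $z$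 is a saddle point. Here $D_v g(z)=\lim_{t\to0^+}\frac{g(z+tv)-g(z)}{t}$ and $D_v^2 g=D_v(D_v g)$. -/

import Mathlib

open Filter Topology MeasureTheory ProbabilityTheory

namespace SAF

/-- The smoothed absolute value `γ`: it is `|t|` for `|t| > β`, and `t² / (2β) + β / 2` otherwise. -/
noncomputable def gam (β t : ℝ) : ℝ :=
  if β < |t| then |t| else t ^ 2 / (2 * β) + β / 2

/-- The contribution of one measurement, with `u = aᵀz` and `v = aᵀx`:
`(γ(|u| / |v|) - 1)² |v|²` if `v ≠ 0`, and `|u|²` by convention if `v = 0`. -/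
noncomputable def term (β u v : ℝ) : ℝ :=
  if v = 0 then |u| ^ 2 else (gam β (|u| / |v|) - 1) ^ 2 * |v| ^ 2

/-- The smoothed amplitude flow loss
`F(z) = (1 / (2m)) ∑ᵢ (γ(|aᵢᵀz| / |aᵢᵀx|) - 1)² |aᵢᵀx|²`. -/
noncomputable def loss {n m : ℕ} (β : ℝ) (a : Fin m → EuclideanSpace ℝ (Fin n))
    (x z : EuclideanSpace ℝ (Fin n)) : ℝ :=
  1 / (2 * (m : ℝ)) * ∑ i, term β (inner ℝ (a i) z) (inner ℝ (a i) x)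

section Landscape

variable {E : Type*} [NormedAddCommGroup E] [InnerProductSpace ℝ E] [CompleteSpace E]

/-- The one-sided directional derivative `D_v g(z) = lim_{t → 0⁺} (g(z + t v) - g(z)) / t` exists
and equals `d`. -/
def HasDirDeriv (g : E → ℝ) (z v : E) (d : ℝ) : Prop :=
  Tendsto (fun t : ℝ => (g (z + t • v) - g z) / t) (𝓝[>] 0) (𝓝 d)

/-- The second order directional derivative `D_v² g(z) = D_v (D_v g)(z)` exists and equals `d`:
the function `h` is `D_v g` at the points `z + t v` with small `t ≥ 0`. -/
def HasDirDeriv2 (g : E → ℝ) (z v : E) (d : ℝ) : Prop :=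
  ∃ h : E → ℝ, (∀ᶠ t : ℝ in 𝓝[≥] 0, HasDirDeriv g (z + t • v) v (h (z + t • v))) ∧
    HasDirDeriv h z v d

/-- `F` has a negative directional curvature at `z`. -/
def HasNegCurvature (F : E → ℝ) (z : E) : Prop :=
  ∃ (v : E) (d : ℝ), v ≠ 0 ∧ HasDirDeriv2 F z v d ∧ d < 0

/-- `F` has no spurious local minima for the target `x`. -/
structure NoSpuriousMinima (F : E → ℝ) (x : E) : Prop where
  /-- The local minimizers are exactly `x` and `-x`. -/
  isLocalMin_iff : ∀ z, IsLocalMin F z ↔ z = x ∨ z = -x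
  /-- The global minimizers are exactly `x` and `-x`. -/
  isGlobalMin_iff : ∀ z, IsMinOn F Set.univ z ↔ z = x ∨ z = -x
  /-- Every other critical point is not a local minimizer and has a negative directional
  curvature. -/
  critical : ∀ z, HasGradientAt F 0 z → z ≠ x → z ≠ -x → ¬ IsLocalMin F z ∧ HasNegCurvature F z
  /-- Every other critical point, except the origin, is not a local maximizer either. -/
  critical_ne_zero : ∀ z, HasGradientAt F 0 z → z ≠ x → z ≠ -x → z ≠ 0 → ¬ IsLocalMax F z

end Landscape

end SAF

namespace SAF

/-! Write `u = aᵀz` and `v = aᵀx`. At a critical point the sums of `slope β u v * u` and `slope β u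
v * v` over the sample vanish, being the derivatives of the loss along `z` and along `x`. So it
suffices that, outside a rare event, every `z ≠ ±x` makes one of these sums nonzero or has negative
one-sided curvature in the direction `x` (`noSpuriousMinima_of_sums`). Nonzero critical points are
not local maxima because the radial derivative grows faster than linearly along a ray.

For Gaussian `a` the expectations of such sums depend only on the Gram matrix of `(z, x)`, hence on
a point of the plane, whatever `n` is. The expected alternative is `pop_alternative`. If `z` is
oblique to `x`, averaging over the reflection of `x` in the line of `z` gives the derivative along
the sphere a strict sign. If `z = c x`, the radial derivative is `c * slope β c 1`, which vanishes
only for `c = 0, ±1`. If `z ≠ 0` is orthogonal to `x`, rotating the pair leaves the expectation of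
`slope * v` unchanged; its zero derivative ties the curvature to the radial derivative and a
strictly positive term, so a vanishing radial derivative forces negative curvature
(`integral_curv_neg_of_orthogonal`). At the origin the curvature is visibly negative.

The sample inherits this by a Chernoff bound on a net and an operator norm bound, uniformly over
balls of `z` (`rare_sum_le_pop`). The true curvature is discontinuous, so it is replaced by the
locally Lipschitz majorants `curvBound`. Rare events are stable under finite unions, so a compact
set of planar Gram data needs only finitely many neighbourhoods, each with a strict alternative
(`rare_stuck_of_isCompact`). What compactness misses is treated directly: large `z` by a quadratic
lower bound (`rare_radial_nonpos`), small punctured balls about `±x` by a strictly outward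
derivative (`exists_rare_near`). -/

/-! ### The loss of one measurement and its derivative -/

/-- `u` clipped to the interval `[-β|v|, β|v|]`. -/
noncomputable def clip (β u v : ℝ) : ℝ := max (-(β * |v|)) (min (β * |v|) u)

/-- The derivative of `term β u v` in `u`. -/
noncomputable def slope (β u v : ℝ) : ℝ :=
  2 * u - (2 / β + 1) * clip β u v + clip β u v ^ 3 / (β ^ 2 * v ^ 2)

variable {β : ℝ}

lemma slope_of_ge (hβ : 0 < β) {u v : ℝ} (h : β * |v| ≤ u) : slope β u v = 2 * u - 2 * |v| := by
  have h0 : 0 ≤ β * |v| := by positivity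
  have hc : clip β u v = β * |v| := by
    rw [clip, min_eq_left h, max_eq_right (by linarith)]
  rw [slope, hc]
  rcases eq_or_ne v 0 with rfl | hv
  · simp
  · have : 0 < |v| := abs_pos.2 hv
    rw [← sq_abs v]; field_simp; ring

lemma slope_of_abs_le {u v : ℝ} (h : |u| ≤ β * |v|) :
    slope β u v = (1 - 2 / β) * u + u ^ 3 / (β ^ 2 * v ^ 2) := by
  have h' := abs_le.1 h
  have hc : clip β u v = u := by
    rw [clip, min_eq_right h'.2, max_eq_right h'.1]
  rw [slope, hc]; ring

lemma clip_neg (hβ : 0 < β) (u v : ℝ) : clip β (-u) v = -clip β u v := by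
  have h0 : 0 ≤ β * |v| := by positivity
  simp only [clip, max_def, min_def]
  split_ifs <;> linarith

lemma slope_neg (hβ : 0 < β) (u v : ℝ) : slope β (-u) v = -slope β u v := by
  rw [slope, slope, clip_neg hβ]; ring

lemma slope_abs_right (u v : ℝ) : slope β u |v| = slope β u v := by
  simp [slope, clip]

lemma slope_of_le_neg (hβ : 0 < β) {u v : ℝ} (h : u ≤ -(β * |v|)) :
    slope β u v = 2 * u + 2 * |v| := by
  have := slope_of_ge hβ (u := -u) (v := v) (by linarith)
  rw [slope_neg hβ] at this; linarith

lemma slope_smul {t : ℝ} (ht : 0 < t) (u v : ℝ) : slope β (t * u) (t * v) = t * slope β u v := by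
  have hc : clip β (t * u) (t * v) = t * clip β u v := by
    simp only [clip, abs_mul, abs_of_pos ht]
    rw [mul_max_of_nonneg _ _ ht.le, mul_min_of_nonneg _ _ ht.le]
    congr 1 <;> [ring; (congr 1; ring)]
  rw [slope, hc, slope]
  rcases eq_or_ne v 0 with rfl | hv
  · simp; ring
  rcases eq_or_ne β 0 with rfl | hb
  · simp; ring
  field_simp

lemma hasDerivAt_max_zero_sq (t : ℝ) :
    HasDerivAt (fun s : ℝ => max s 0 ^ 2) (2 * max t 0) t := by
  rcases lt_trichotomy t 0 with h | rfl | h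
  · rw [max_eq_right h.le, mul_zero]
    refine (hasDerivAt_const t (0 : ℝ)).congr_of_eventuallyEq ?_
    filter_upwards [gt_mem_nhds h] with s hs
    simp [max_eq_right hs.le]
  · rw [max_self, mul_zero, hasDerivAt_iff_isLittleO_nhds_zero]
    refine Asymptotics.IsBigO.trans_isLittleO (g := fun h : ℝ => h ^ 2) ?_ ?_
    · refine Asymptotics.isBigO_of_le _ fun h => ?_
      simp only [zero_add, max_self, smul_zero, sub_zero, norm_pow, Real.norm_eq_abs, ne_eq,
        OfNat.ofNat_ne_zero, not_false_eq_true, zero_pow]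
      refine pow_le_pow_left₀ (abs_nonneg _) ?_ 2
      rw [abs_of_nonneg (le_max_right h 0)]
      exact max_le (le_abs_self h) (abs_nonneg h)
    · simpa using Asymptotics.isLittleO_pow_id (𝕜 := ℝ) one_lt_two
  · rw [max_eq_left h.le]
    have := (hasDerivAt_pow 2 t)
    simp only [Nat.cast_ofNat, Nat.add_one_sub_one, pow_one] at this
    refine this.congr_of_eventuallyEq ?_
    filter_upwards [lt_mem_nhds h] with s hs
    simp [max_eq_left hs.le]

/-- Removing squares of positive parts from the parabola exhibits `γ` as a combination of C¹
functions, so that no gluing at `±β` is needed. -/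
lemma gam_eq (hβ : 0 < β) (t : ℝ) : gam β t =
    t ^ 2 / (2 * β) + β / 2 - (max (t - β) 0 ^ 2 + max (-t - β) 0 ^ 2) / (2 * β) := by
  unfold gam
  split_ifs with h
  · rcases lt_abs.1 h with h | h
    · rw [max_eq_left (by linarith), max_eq_right (by linarith), abs_of_pos (by linarith)]
      field_simp; ring
    · rw [max_eq_right (by linarith), max_eq_left (by linarith), abs_of_neg (by linarith)]
      field_simp; ring
  · rw [not_lt, abs_le] at h
    rw [max_eq_right (by linarith), max_eq_right (by linarith)]
    simp

lemma hasDerivAt_gam (hβ : 0 < β) (t : ℝ) :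
    HasDerivAt (gam β) ((t - max (t - β) 0 + max (-t - β) 0) / β) t := by
  have e : gam β = fun t => t ^ 2 / (2 * β) + β / 2 -
      (max (t - β) 0 ^ 2 + max (-t - β) 0 ^ 2) / (2 * β) := funext (gam_eq hβ)
  rw [e]
  have h1 := (hasDerivAt_max_zero_sq (t - β)).comp t ((hasDerivAt_id t).sub_const β)
  have h2 := (hasDerivAt_max_zero_sq (-t - β)).comp t ((hasDerivAt_neg t).sub_const β)
  have h3 := (((hasDerivAt_pow 2 t).div_const (2 * β)).add_const (β / 2)).sub
    ((h1.add h2).div_const (2 * β))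
  refine h3.congr_deriv ?_
  simp
  field_simp
  ring

lemma gam_abs (t : ℝ) : gam β |t| = gam β t := by simp [gam]

lemma gam_one (hβ' : β ≤ 1 / 2) : gam β 1 = 1 := by
  rw [gam, if_pos (by simp; linarith)]; simp

/-- The clip is zero and division by zero returns zero, so `slope` agrees with the convention `|u|²`
for a vanishing `v`. -/
lemma slope_zero_right (u : ℝ) : slope β u 0 = 2 * u := by
  have : clip β u 0 = 0 := by simp [clip]
  simp [slope, this]

/-- Homogeneity for scalars of either sign: `slope` is odd in `u` and even in `v`. -/
lemma slope_mul_self (hβ : 0 < β) (s v : ℝ) : slope β (s * v) v = v * slope β s 1 := by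
  rcases lt_trichotomy v 0 with hv | rfl | hv
  · have := slope_smul (β := β) (neg_pos.2 hv) (-s) 1
    rw [slope_neg hβ, ← abs_of_neg hv, mul_one, slope_abs_right, abs_of_neg hv] at this
    rw [show s * v = -v * -s by ring, this]; ring
  · simp [slope_zero_right]
  · have := slope_smul (β := β) hv s 1
    rwa [mul_one, mul_comm v s] at this

/-- The chain rule for `(γ(s) - 1)²`; the general denominator `v` then follows from homogeneity. -/
lemma two_mul_gam_sub_one_mul (hβ : 0 < β) (s : ℝ) :
    2 * (gam β s - 1) * ((s - max (s - β) 0 + max (-s - β) 0) / β) = slope β s 1 := by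
  rw [gam_eq hβ]
  rcases le_total β s with h | h
  · rw [slope_of_ge hβ (by simpa using h), max_eq_left (by linarith), max_eq_right (by linarith)]
    field_simp; simp; ring
  rcases le_total s (-β) with h' | h'
  · rw [slope_of_le_neg hβ (by simpa using h'), max_eq_right (by linarith),
      max_eq_left (by linarith)]
    field_simp; simp; ring
  · rw [slope_of_abs_le (by simpa using abs_le.2 ⟨h', h⟩), max_eq_right (by linarith),
      max_eq_right (by linarith)]
    field_simp; ring

lemma term_of_ne {v : ℝ} (hv : v ≠ 0) (u : ℝ) :
    term β u v = (gam β (u / v) - 1) ^ 2 * v ^ 2 := by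
  rw [term, if_neg hv, ← abs_div, gam_abs, sq_abs]

lemma hasDerivAt_term (hβ : 0 < β) (u v : ℝ) :
    HasDerivAt (fun u => term β u v) (slope β u v) u := by
  rcases eq_or_ne v 0 with rfl | hv
  · simp only [term, if_true, sq_abs, slope_zero_right]
    simpa using hasDerivAt_pow 2 u
  · simp only [term_of_ne hv]
    have h1 := ((hasDerivAt_gam hβ (u / v)).comp u ((hasDerivAt_id u).div_const v)).sub_const 1
    refine ((h1.pow 2).mul_const (v ^ 2)).congr_deriv ?_
    have h2 := two_mul_gam_sub_one_mul hβ (u / v)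
    have h3 := slope_mul_self hβ (u / v) v
    rw [div_mul_cancel₀ _ hv] at h3
    rw [h3, ← h2]
    simp
    field_simp

lemma term_nonneg (u v : ℝ) : 0 ≤ term β u v := by
  unfold term; split_ifs <;> positivity

lemma term_self (hβ' : β ≤ 1 / 2) (v : ℝ) : term β v v = 0 := by
  rcases eq_or_ne v 0 with rfl | hv
  · simp [term]
  · rw [term_of_ne hv, div_self hv, gam_one hβ']; simp

lemma term_neg (u v : ℝ) : term β (-u) v = term β u v := by simp [term]

/-! ### One-sided curvature and monotonicity of the slope -/

/-- An upper bound for the right second derivative of `t ↦ term β (u + t v) v` at `0`; it decreases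
to that derivative as `k → ∞` if `|u| ≠ β|v|`. -/
noncomputable def curvBound (β : ℝ) (k : ℕ) (u v : ℝ) : ℝ :=
  min (2 * v ^ 2) (3 / β ^ 2 * u ^ 2 + (1 - 2 / β) * v ^ 2 +
    (k + 1) * (2 / β - 2) / β ^ 2 * max (u ^ 2 - (1 - 1 / (k + 1)) * β ^ 2 * v ^ 2) 0)

/-- The ramp starts `β²v²/(k+1)` below the threshold `u² = β²v²` with steepness proportional to
`k+1`. At the threshold it has gained exactly `(2/β - 2)v²`, the amount that lifts the inner formula
to at least `2v²`. -/
lemma curvBound_of_ge (hβ : 0 < β) (hβ' : β ≤ 1 / 2) (k : ℕ) {u v : ℝ} (h : β * |v| ≤ |u|) :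
    curvBound β k u v = 2 * v ^ 2 := by
  have hk : (0 : ℝ) < k + 1 := by positivity
  have hb : 2 ≤ 1 / β := by rw [le_div_iff₀ hβ]; linarith
  have h2 : β ^ 2 * v ^ 2 ≤ u ^ 2 := by
    have := pow_le_pow_left₀ (by positivity) h 2
    rwa [mul_pow, sq_abs, sq_abs] at this
  have h3 : v ^ 2 ≤ u ^ 2 / β ^ 2 := by rw [le_div_iff₀ (by positivity)]; linarith
  refine min_eq_left ?_
  have h4 : (k + 1) * (2 / β - 2) / β ^ 2 * (β ^ 2 * v ^ 2 / (k + 1)) ≤ (k + 1) * (2 / β - 2) / β ^ 2 *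
      max (u ^ 2 - (1 - 1 / (k + 1)) * β ^ 2 * v ^ 2) 0 := by
    have : 0 ≤ 2 / β - 2 := by have := hb; rw [show 2 / β = 2 * (1 / β) by ring]; linarith
    refine mul_le_mul_of_nonneg_left (le_max_of_le_left ?_) (by positivity)
    have : (1 - 1 / ((k : ℝ) + 1)) * β ^ 2 * v ^ 2 = β ^ 2 * v ^ 2 - β ^ 2 * v ^ 2 / (k + 1) := by
      ring
    linarith
  have h5 : (k + 1) * (2 / β - 2) / β ^ 2 * (β ^ 2 * v ^ 2 / (k + 1)) = (2 / β - 2) * v ^ 2 := by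
    field_simp
  have h6 : 3 / β ^ 2 * u ^ 2 = 3 * (u ^ 2 / β ^ 2) := by ring
  rw [h5] at h4
  rw [h6]
  nlinarith

lemma le_curvBound_of_le (hβ : 0 < β) (hβ' : β ≤ 1 / 2) (k : ℕ) {u v : ℝ} (h : |u| ≤ β * |v|) :
    3 / β ^ 2 * u ^ 2 + (1 - 2 / β) * v ^ 2 ≤ curvBound β k u v := by
  have hb : 2 ≤ 1 / β := by rw [le_div_iff₀ hβ]; linarith
  have hb2 : 2 / β = 2 * (1 / β) := by ring
  have h2 : u ^ 2 ≤ β ^ 2 * v ^ 2 := by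
    have := pow_le_pow_left₀ (by positivity) h 2
    rwa [mul_pow, sq_abs, sq_abs] at this
  have h3 : u ^ 2 / β ^ 2 ≤ v ^ 2 := by rw [div_le_iff₀ (by positivity)]; linarith
  have h6 : 3 / β ^ 2 * u ^ 2 = 3 * (u ^ 2 / β ^ 2) := by ring
  refine le_min ?_ ?_
  · rw [h6, hb2]; nlinarith [sq_nonneg v]
  · have : 0 ≤ 2 / β - 2 := by linarith
    have : 0 ≤ (k + 1) * (2 / β - 2) / β ^ 2 * max (u ^ 2 - (1 - 1 / (k + 1)) * β ^ 2 * v ^ 2) 0 :=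
      mul_nonneg (by positivity) (le_max_right _ _)
    linarith

/-- Off the kinks `|u| = β|v|` one smooth piece governs both sides. At a kink the sign of `u v`
tells whether `u + t v` moves outward or inward for small `t > 0`, and `curvBound` dominates the
second derivative of either piece there. -/
lemma exists_right_deriv_slope (hβ : 0 < β) (hβ' : β ≤ 1 / 2) (k : ℕ) (u v : ℝ) :
    ∃ d ≤ curvBound β k u v,
      Tendsto (fun t : ℝ => (slope β (u + t * v) v * v - slope β u v * v) / t) (𝓝[>] 0) (𝓝 d) := by
  have hpos : ∀ᶠ t : ℝ in 𝓝[>] 0, 0 < t := self_mem_nhdsWithin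
  have hcont : ∀ c : ℝ, Tendsto (fun t : ℝ => c * (u + t * v)) (𝓝[>] 0) (𝓝 (c * u)) := by
    intro c
    have : Continuous fun t : ℝ => c * (u + t * v) := by fun_prop
    simpa using (this.tendsto 0).mono_left nhdsWithin_le_nhds
  have outer : ∀ c : ℝ, (c = 1 ∨ c = -1) → β * |v| ≤ c * u →
      (∀ᶠ t : ℝ in 𝓝[>] 0, β * |v| ≤ c * (u + t * v)) → ∃ d ≤ curvBound β k u v,
      Tendsto (fun t : ℝ => (slope β (u + t * v) v * v - slope β u v * v) / t) (𝓝[>] 0) (𝓝 d) := by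
    intro c hc hu hev
    have hform : ∀ w, β * |v| ≤ c * w → slope β w v = 2 * w - c * 2 * |v| := by
      intro w hw
      rcases hc with rfl | rfl
      · rw [slope_of_ge hβ (by linarith)]; ring
      · rw [slope_of_le_neg hβ (by linarith)]; ring
    refine ⟨2 * v ^ 2, (curvBound_of_ge hβ hβ' k ?_).ge, ?_⟩
    · rcases hc with rfl | rfl
      · exact hu.trans (by simpa using le_abs_self u)
      · exact hu.trans (by simpa using neg_le_abs u)
    · refine tendsto_const_nhds.congr' ?_
      filter_upwards [hev, hpos] with t ht ht0
      rw [hform _ hu, hform _ ht]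
      field_simp; ring
  have inner : |u| ≤ β * |v| → (∀ᶠ t : ℝ in 𝓝[>] 0, |u + t * v| ≤ β * |v|) →
      ∃ d ≤ curvBound β k u v,
      Tendsto (fun t : ℝ => (slope β (u + t * v) v * v - slope β u v * v) / t) (𝓝[>] 0) (𝓝 d) := by
    intro hu hev
    refine ⟨3 / β ^ 2 * u ^ 2 + (1 - 2 / β) * v ^ 2, le_curvBound_of_le hβ hβ' k hu, ?_⟩
    have h0 : HasDerivAt (fun t : ℝ => u + t * v) v 0 := by
      simpa using ((hasDerivAt_id (0 : ℝ)).mul_const v).const_add u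
    have h1 := (((h0.const_mul (1 - 2 / β)).add ((h0.pow 3).div_const (β ^ 2 * v ^ 2))).mul_const
      v).tendsto_slope_zero_right
    have e : ((1 - 2 / β) * v + (((3 : ℕ) : ℝ) * (u + 0 * v) ^ (3 - 1) * v) / (β ^ 2 * v ^ 2)) * v
        = 3 / β ^ 2 * u ^ 2 + (1 - 2 / β) * v ^ 2 := by
      rcases eq_or_ne v 0 with rfl | hv
      · have : u = 0 := by simpa using hu
        simp [this]
      · simp; field_simp; ring
    rw [e] at h1
    refine h1.congr' ?_
    filter_upwards [hev] with t ht
    rw [slope_of_abs_le hu, slope_of_abs_le ht]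
    simp
    ring
  rcases lt_trichotomy (|u|) (β * |v|) with h | h | h
  · refine inner h.le ?_
    have := (hcont 1).abs.eventually_lt_const (u := β * |v|) (by simpa using h)
    filter_upwards [this] with t ht
    simpa using ht.le
  · rcases eq_or_ne v 0 with rfl | hv
    · have : u = 0 := by simpa using h
      exact inner h.le (Eventually.of_forall fun t => by simp [this])
    have key : ∀ c : ℝ, (c = 1 ∨ c = -1) → |u| = c * u → ∃ d ≤ curvBound β k u v,
      Tendsto (fun t : ℝ => (slope β (u + t * v) v * v - slope β u v * v) / t) (𝓝[>] 0) (𝓝 d) := by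
      intro c hc hu
      rcases le_total 0 (c * v) with hv' | hv'
      · refine outer c hc (by linarith) ?_
        filter_upwards [hpos] with t ht
        nlinarith
      · refine inner h.le ?_
        have h2 : 0 < β * |v| := by positivity
        have := (hcont c).eventually (lt_mem_nhds (a := 0) (by linarith))
        filter_upwards [hpos, this] with t ht ht'
        have e1 : |u + t * v| = c * (u + t * v) := by
          rw [← abs_of_pos ht', abs_mul]
          rcases hc with rfl | rfl <;> simp
        rw [e1]
        nlinarith
    rcases le_total 0 u with hu | hu
    · exact key 1 (Or.inl rfl) (by rw [abs_of_nonneg hu, one_mul])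
    · exact key (-1) (Or.inr rfl) (by rw [abs_of_nonpos hu]; ring)
  · have key : ∀ c : ℝ, (c = 1 ∨ c = -1) → |u| = c * u → ∃ d ≤ curvBound β k u v,
      Tendsto (fun t : ℝ => (slope β (u + t * v) v * v - slope β u v * v) / t) (𝓝[>] 0) (𝓝 d) := by
      intro c hc hu
      refine outer c hc (by linarith) ?_
      filter_upwards [(hcont c).eventually (lt_mem_nhds (a := β * |v|) (by linarith))] with t ht
      exact ht.le
    rcases le_total 0 u with hu | hu
    · exact key 1 (Or.inl rfl) (by rw [abs_of_nonneg hu, one_mul])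
    · exact key (-1) (Or.inr rfl) (by rw [abs_of_nonpos hu]; ring)

/-- `slope β (t u) v * u / t` is strictly increasing in `t > 0`, stated at `t = 1`. -/
lemma mul_slope_lt (hβ : 0 < β) {u v t : ℝ} (hu : u ≠ 0) (hv : v ≠ 0) (ht : 1 < t) :
    t * (slope β u v * u) < slope β (t * u) v * u := by
  wlog hu0 : 0 < u generalizing u
  · have := this (u := -u) (by simpa using hu) (by
      rcases lt_or_gt_of_ne hu with h | h
      · linarith
      · exact absurd h hu0)
    rw [mul_neg t u, slope_neg hβ, slope_neg hβ] at this
    linarith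
  have hv' : 0 < |v| := abs_pos.2 hv
  have key : t * slope β u v < slope β (t * u) v := by
    have hcase1 : ∀ w r : ℝ, 1 < r → β * |v| ≤ w → r * slope β w v < slope β (r * w) v := by
      intro w r hr hw
      have : w ≤ r * w := by nlinarith [mul_pos hβ hv']
      rw [slope_of_ge hβ hw, slope_of_ge hβ (hw.trans this)]
      nlinarith
    have hcase2 : ∀ w r : ℝ, 1 < r → 0 < w → r * w ≤ β * |v| →
        r * slope β w v < slope β (r * w) v := by
      intro w r hr hw hrw
      have : w ≤ r * w := by nlinarith
      rw [slope_of_abs_le (by rw [abs_of_pos hw]; linarith),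
        slope_of_abs_le (by rw [abs_of_pos (by positivity)]; linarith)]
      have : 0 < w ^ 3 / (β ^ 2 * v ^ 2) * (r ^ 3 - r) := by
        have : 0 < r ^ 3 - r := by nlinarith [sq_nonneg (r - 1), mul_pos (by linarith : 0 < r) (by linarith : 0 < r - 1)]
        positivity
      calc _ < r * ((1 - 2 / β) * w + w ^ 3 / (β ^ 2 * v ^ 2)) +
            w ^ 3 / (β ^ 2 * v ^ 2) * (r ^ 3 - r) := by linarith
        _ = _ := by ring
    rcases le_total (β * |v|) u with h | h
    · exact hcase1 u t ht h
    rcases le_total (t * u) (β * |v|) with h' | h'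
    · exact hcase2 u t ht hu0 h'
    set r := β * |v| / u with hr
    have hru : r * u = β * |v| := by rw [hr]; field_simp
    have hr1 : 1 ≤ r := by rw [hr, le_div_iff₀ hu0]; linarith
    have hrt : r ≤ t := by rw [hr, div_le_iff₀ hu0]; linarith
    rcases hr1.eq_or_lt with h1 | h1
    · exact hcase1 u t ht (by rw [← hru, ← h1, one_mul])
    rcases hrt.eq_or_lt with h2 | h2
    · exact hcase2 u t ht hu0 (by rw [← h2, hru])
    have a1 := hcase2 u r h1 hu0 hru.le
    have a2 := hcase1 (r * u) (t / r) (by rw [lt_div_iff₀ (by linarith)]; linarith) hru.ge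
    have htr : t / r * r = t := div_mul_cancel₀ _ (by linarith)
    rw [← mul_assoc, htr] at a2
    have a3 := mul_lt_mul_of_pos_left a1 (show 0 < t / r by positivity)
    rw [← mul_assoc, htr] at a3
    exact a3.trans a2
  have := mul_lt_mul_of_pos_right key hu0
  linarith

/-! ### From sums over the sample to the landscape of the loss -/

section Landscape

variable {n m : ℕ} {a : Fin m → EuclideanSpace ℝ (Fin n)} {x : EuclideanSpace ℝ (Fin n)}

lemma hasDerivAt_loss_line (hβ : 0 < β) (a : Fin m → EuclideanSpace ℝ (Fin n))
    (x z y : EuclideanSpace ℝ (Fin n)) (t : ℝ) :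
    HasDerivAt (fun t : ℝ => loss β a x (z + t • y))
      (1 / (2 * (m : ℝ)) * ∑ i, slope β (inner ℝ (a i) (z + t • y)) (inner ℝ (a i) x) *
        inner ℝ (a i) y) t := by
  unfold loss
  refine HasDerivAt.const_mul _ (HasDerivAt.fun_sum fun i _ => ?_)
  have h0 : HasDerivAt (fun t : ℝ => inner ℝ (a i) (z + t • y)) (inner ℝ (a i) y) t := by
    simp only [inner_add_right, inner_smul_right]
    simpa using ((hasDerivAt_id t).mul_const (inner ℝ (a i) y)).const_add (inner ℝ (a i) z)
  exact (hasDerivAt_term hβ _ _).comp t h0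

lemma differentiable_loss (hβ : 0 < β) : Differentiable ℝ (loss β a x) := by
  intro z
  unfold loss
  refine DifferentiableAt.const_mul (DifferentiableAt.fun_sum fun i _ => ?_) _
  exact (hasDerivAt_term hβ _ _).differentiableAt.comp z
    (f := fun z => inner ℝ (a i) z)
    (innerSL ℝ (a i)).differentiableAt

lemma sum_slope_eq_zero (hβ : 0 < β) (hm : 0 < m) {z : EuclideanSpace ℝ (Fin n)}
    (hz : HasGradientAt (loss β a x) 0 z) (y : EuclideanSpace ℝ (Fin n)) :
    ∑ i, slope β (inner ℝ (a i) z) (inner ℝ (a i) x) * inner ℝ (a i) y = 0 := by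
  have h1 := hasDerivAt_loss_line hβ a x z y 0
  have h0 : HasDerivAt (fun t : ℝ => z + t • y) y 0 := by
    simpa using ((hasDerivAt_id (0 : ℝ)).smul_const y).const_add z
  have hz' : HasFDerivAt (loss β a x) (0 : EuclideanSpace ℝ (Fin n) →L[ℝ] ℝ) (z + (0 : ℝ) • y) := by
    simpa using hz.hasFDerivAt
  have h2 := h1.unique (show HasDerivAt (fun t : ℝ => loss β a x (z + t • y)) 0 0 from
    (HasFDerivAt.comp_hasDerivAt (f := fun t : ℝ => z + t • y) (l := loss β a x) 0 hz'
      h0).congr_deriv (by simp))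
  have hm' : (0 : ℝ) < m := by exact_mod_cast hm
  simpa [hm'.ne'] using h2

lemma loss_nonneg (z : EuclideanSpace ℝ (Fin n)) : 0 ≤ loss β a x z :=
  mul_nonneg (by positivity) (Finset.sum_nonneg fun _ _ => term_nonneg _ _)

lemma loss_neg (z : EuclideanSpace ℝ (Fin n)) : loss β a x (-z) = loss β a x z := by
  simp [loss, term_neg]

lemma loss_self (hβ' : β ≤ 1 / 2) : loss β a x x = 0 := by
  simp [loss, term_self hβ']

lemma hasGradientAt_zero_of_isLocalMin (hβ : 0 < β) {z : EuclideanSpace ℝ (Fin n)}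
    (h : IsLocalMin (loss β a x) z) : HasGradientAt (loss β a x) 0 z := by
  have := (differentiable_loss (a := a) (x := x) hβ z).hasFDerivAt
  rw [h.fderiv_eq_zero] at this
  rw [hasGradientAt_iff_hasFDerivAt]
  simpa using this

lemma HasDerivAt.hasDirDeriv {E : Type*} [NormedAddCommGroup E] [InnerProductSpace ℝ E]
    {g : E → ℝ} {z v : E} {d : ℝ} (h : HasDerivAt (fun t : ℝ => g (z + t • v)) d 0) :
    HasDirDeriv g z v d := by
  refine h.tendsto_slope_zero_right.congr fun t => ?_
  simp [div_eq_inv_mul]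

lemma exists_hasDirDeriv2_neg (hβ : 0 < β) (hβ' : β ≤ 1 / 2) (hm : 0 < m)
    {z : EuclideanSpace ℝ (Fin n)} {k : ℕ}
    (hk : ∑ i, curvBound β k (inner ℝ (a i) z) (inner ℝ (a i) x) < 0) :
    ∃ d < 0, HasDirDeriv2 (loss β a x) z x d ∧ Tendsto (fun t : ℝ => (1 / (2 * (m : ℝ)) *
        (∑ i, slope β (inner ℝ (a i) (z + t • x)) (inner ℝ (a i) x) * inner ℝ (a i) x) -
        1 / (2 * (m : ℝ)) * ∑ i, slope β (inner ℝ (a i) z) (inner ℝ (a i) x) * inner ℝ (a i) x) / t)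
      (𝓝[>] 0) (𝓝 d) := by
  choose d hd hlim using fun i =>
    exists_right_deriv_slope hβ hβ' k (inner ℝ (a i) z) (inner ℝ (a i) x)
  have hm' : (0 : ℝ) < m := by exact_mod_cast hm
  have hT : Tendsto (fun t : ℝ => (1 / (2 * (m : ℝ)) *
        (∑ i, slope β (inner ℝ (a i) (z + t • x)) (inner ℝ (a i) x) * inner ℝ (a i) x) -
        1 / (2 * (m : ℝ)) * ∑ i, slope β (inner ℝ (a i) z) (inner ℝ (a i) x) * inner ℝ (a i) x) / t)
      (𝓝[>] 0) (𝓝 (1 / (2 * (m : ℝ)) * ∑ i, d i)) := by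
    refine ((tendsto_finsetSum Finset.univ fun i _ => hlim i).const_mul
      (1 / (2 * (m : ℝ)))).congr fun t => ?_
    rw [← mul_sub, ← Finset.sum_sub_distrib, mul_div_assoc, Finset.sum_div]
    simp only [inner_add_right, inner_smul_right]
  refine ⟨1 / (2 * (m : ℝ)) * ∑ i, d i, ?_, ⟨fun w => 1 / (2 * (m : ℝ)) * ∑ i,
    slope β (inner ℝ (a i) w) (inner ℝ (a i) x) * inner ℝ (a i) x, ?_, ?_⟩, hT⟩
  · refine mul_neg_of_pos_of_neg (by positivity) (lt_of_le_of_lt ?_ hk)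
    exact Finset.sum_le_sum fun i _ => hd i
  · refine Eventually.of_forall fun t => HasDerivAt.hasDirDeriv ?_
    simpa using hasDerivAt_loss_line hβ a x (z + t • x) x 0
  · exact hT

/-- Second derivative test for one-sided second derivatives. -/
lemma frequently_lt_of_right_deriv2_neg {f f' : ℝ → ℝ} {d : ℝ} (hf : ∀ t, HasDerivAt f (f' t) t)
    (h0 : f' 0 = 0) (hd : d < 0) (hlim : Tendsto (fun t => (f' t - f' 0) / t) (𝓝[>] 0) (𝓝 d)) :
    ∀ᶠ t in 𝓝[>] (0 : ℝ), f t < f 0 := by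
  have h1 := hlim.eventually_lt_const hd
  rw [eventually_nhdsWithin_iff, Metric.eventually_nhds_iff] at h1
  obtain ⟨ε, hε, h1⟩ := h1
  filter_upwards [Ioo_mem_nhdsGT hε] with t ht
  refine strictAntiOn_of_deriv_neg (convex_Icc 0 t)
    (fun s _ => (hf s).continuousAt.continuousWithinAt) ?_ (Set.left_mem_Icc.2 ht.1.le)
    (Set.right_mem_Icc.2 ht.1.le) ht.1
  intro s hs
  rw [interior_Icc] at hs
  rw [(hf s).deriv]
  have := h1 (y := s) (by rw [Real.dist_eq, sub_zero, abs_of_pos hs.1]; linarith [hs.2, ht.2]) hs.1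
  rw [h0, sub_zero] at this
  by_contra hcon
  exact this.not_ge (div_nonneg (not_lt.1 hcon) hs.1.le)

/-- The deterministic core. At a critical point the first two alternatives are impossible, so the
third gives descent along `x`; local minimizers are critical, which settles the rest of the
minimizer statements. The hypothesis `hnz` makes the radial growth strict, excluding local maxima.
-/
theorem noSpuriousMinima_of_sums (hβ : 0 < β) (hβ' : β ≤ 1 / 2) (hx : x ≠ 0)
    (hnz : ∀ z ≠ 0, ∃ i, inner ℝ (a i) z ≠ 0 ∧ inner ℝ (a i) x ≠ 0)
    (hcrit : ∀ z, z ≠ x → z ≠ -x →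
      ∑ i, slope β (inner ℝ (a i) z) (inner ℝ (a i) x) * inner ℝ (a i) z ≠ 0 ∨
      ∑ i, slope β (inner ℝ (a i) z) (inner ℝ (a i) x) * inner ℝ (a i) x ≠ 0 ∨
      ∃ k, ∑ i, curvBound β k (inner ℝ (a i) z) (inner ℝ (a i) x) < 0) :
    NoSpuriousMinima (loss β a x) x := by
  have hm : 0 < m := by
    obtain ⟨i, -⟩ := hnz x hx
    exact i.pos
  have hm' : (0 : ℝ) < m := by exact_mod_cast hm
  have crit : ∀ z, HasGradientAt (loss β a x) 0 z → z ≠ x → z ≠ -x →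
      ¬ IsLocalMin (loss β a x) z ∧ HasNegCurvature (loss β a x) z := by
    intro z hz h1 h2
    obtain h | h | ⟨k, hk⟩ := hcrit z h1 h2
    · exact absurd (sum_slope_eq_zero hβ hm hz z) h
    · exact absurd (sum_slope_eq_zero hβ hm hz x) h
    obtain ⟨d, hd, hd2, hlim⟩ := exists_hasDirDeriv2_neg hβ hβ' hm hk
    refine ⟨fun hmin => ?_, x, d, hx, hd2, hd⟩
    have h3 := frequently_lt_of_right_deriv2_neg (hasDerivAt_loss_line hβ a x z x)
      (by simp [sum_slope_eq_zero hβ hm hz x]) hd (by simpa using hlim)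
    have h4 : Tendsto (fun t : ℝ => z + t • x) (𝓝[>] 0) (𝓝 z) := by
      have : Continuous fun t : ℝ => z + t • x := by fun_prop
      simpa using (this.tendsto 0).mono_left nhdsWithin_le_nhds
    obtain ⟨t, ht, ht'⟩ := (h3.and (h4.eventually hmin)).exists
    simp only [zero_smul, add_zero] at ht
    exact ht.not_ge ht'
  have hmin : ∀ z, z = x ∨ z = -x → IsMinOn (loss β a x) Set.univ z := by
    intro z hz w _
    have : loss β a x z = 0 := by
      rcases hz with rfl | rfl
      · exact loss_self hβ'
      · rw [loss_neg, loss_self hβ']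
    simpa [this] using loss_nonneg w
  have hloc : ∀ z, IsLocalMin (loss β a x) z → z = x ∨ z = -x := by
    intro z hz
    by_contra! hcon
    exact (crit z (hasGradientAt_zero_of_isLocalMin hβ hz) hcon.1 hcon.2).1 hz
  refine ⟨fun z => ⟨hloc z, fun h => (hmin z h).isLocalMin univ_mem⟩,
    fun z => ⟨fun h => hloc z (h.isLocalMin univ_mem), hmin z⟩, crit, ?_⟩
  intro z hz _ _ hz0 hmax
  obtain ⟨j, hju, hjv⟩ := hnz z hz0
  -- At `(1 + s) z` each summand of the derivative along `z` is at least `1 + s` times its value at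
  -- `z`, strictly for `j`; these values sum to zero, so the loss increases along the ray.
  have hgrow : ∀ t : ℝ, 0 < t → loss β a x z < loss β a x (z + t • z) := by
    intro t ht
    have := strictMonoOn_of_deriv_pos (f := fun t : ℝ => loss β a x (z + t • z)) (convex_Icc 0 t)
      (fun s _ => (hasDerivAt_loss_line hβ a x z z s).continuousAt.continuousWithinAt) (by
        intro s hs
        rw [interior_Icc] at hs
        rw [(hasDerivAt_loss_line hβ a x z z s).deriv]
        refine mul_pos (by positivity) ?_
        have h0 := sum_slope_eq_zero hβ hm hz z
        have h1 : ∑ i, (1 + s) * (slope β (inner ℝ (a i) z) (inner ℝ (a i) x) * inner ℝ (a i) z) <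
            ∑ i, slope β (inner ℝ (a i) (z + s • z)) (inner ℝ (a i) x) * inner ℝ (a i) z := by
          have e : ∀ i, inner ℝ (a i) (z + s • z) = (1 + s) * inner ℝ (a i) z := by
            intro i; rw [inner_add_right, inner_smul_right]; ring
          simp only [e]
          refine Finset.sum_lt_sum (fun i _ => ?_)
            ⟨j, Finset.mem_univ _, mul_slope_lt hβ hju hjv (by linarith [hs.1])⟩
          rcases eq_or_ne (inner ℝ (a i) z) 0 with hu | hu
          · simp [hu]
          rcases eq_or_ne (inner ℝ (a i) x) 0 with hv | hv
          · rw [hv, slope_zero_right, slope_zero_right]; apply le_of_eq; ring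
          · exact (mul_slope_lt hβ hu hv (by linarith [hs.1])).le
        rwa [← Finset.mul_sum, h0, mul_zero] at h1) (Set.left_mem_Icc.2 ht.le)
        (Set.right_mem_Icc.2 ht.le) ht
    simpa using this
  have h4 : Tendsto (fun t : ℝ => z + t • z) (𝓝[>] 0) (𝓝 z) := by
    have : Continuous fun t : ℝ => z + t • z := by fun_prop
    simpa using (this.tendsto 0).mono_left nhdsWithin_le_nhds
  have hpos : ∀ᶠ t : ℝ in 𝓝[>] 0, 0 < t := self_mem_nhdsWithin
  obtain ⟨t, ht, ht'⟩ := (hpos.and (h4.eventually hmax)).exists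
  exact (hgrow t ht).not_ge ht'

end Landscape

/-! ### Gaussian pairs and their Gram matrices -/

section Gram

variable {E F : Type*} [NormedAddCommGroup E] [InnerProductSpace ℝ E]
  [NormedAddCommGroup F] [InnerProductSpace ℝ F]

/-- The pairs `(z, x)` and `(w, y)` have the same Gram matrix. -/
structure SameGram (z x : E) (w y : F) : Prop where
  norm_left : ‖z‖ = ‖w‖
  norm_right : ‖x‖ = ‖y‖
  inner_eq : inner ℝ z x = inner ℝ w y

lemma SameGram.norm_comb {z x : E} {w y : F} (h : SameGram z x w y) (p q : ℝ) :
    ‖p • z + q • x‖ = ‖p • w + q • y‖ := by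
  have : ‖p • z + q • x‖ ^ 2 = ‖p • w + q • y‖ ^ 2 := by
    rw [norm_add_sq_real, norm_add_sq_real]
    simp only [norm_smul, inner_smul_left, inner_smul_right, h.norm_left, h.norm_right, h.inner_eq]
  exact (sq_eq_sq₀ (norm_nonneg _) (norm_nonneg _)).1 this

/-- The first basis vector of the plane. -/
noncomputable def e₀ : EuclideanSpace ℝ (Fin 2) := !₂[1, 0]

lemma norm_e₀ : ‖e₀‖ = 1 := by simp [e₀, EuclideanSpace.norm_eq]

/-- The coordinates are the component of `z` along `x` and the length of the remainder. This planar
model is what makes all constants independent of `n`. -/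
lemma exists_sameGram (z x : E) (hx : ‖x‖ = 1) :
    ∃ ζ : EuclideanSpace ℝ (Fin 2), SameGram z x ζ e₀ := by
  have h0 : 0 ≤ ‖z‖ ^ 2 - inner ℝ z x ^ 2 := by
    have := abs_real_inner_le_norm z x
    rw [hx, mul_one] at this
    have := pow_le_pow_left₀ (abs_nonneg _) this 2
    rw [sq_abs] at this
    linarith
  refine ⟨!₂[inner ℝ z x, √(‖z‖ ^ 2 - inner ℝ z x ^ 2)], ⟨?_, by rw [hx, norm_e₀], ?_⟩⟩
  · rw [EuclideanSpace.norm_eq]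
    simp [Real.sq_sqrt h0]
  · simp [e₀, PiLp.inner_apply]

variable [FiniteDimensional ℝ E] [MeasurableSpace E] [BorelSpace E]
  [FiniteDimensional ℝ F] [MeasurableSpace F] [BorelSpace F]

lemma measurable_inner_pair (z x : E) :
    Measurable fun g : E => ((inner ℝ g z, inner ℝ g x) : ℝ × ℝ) := by fun_prop

/-- The characteristic function of the pair depends only on the norms of linear combinations of the
two vectors, hence on their Gram matrix. -/
lemma SameGram.map_eq {z x : E} {w y : F} (h : SameGram z x w y) :
    (stdGaussian E).map (fun g => ((inner ℝ g z, inner ℝ g x) : ℝ × ℝ)) =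
      (stdGaussian F).map (fun g => ((inner ℝ g w, inner ℝ g y) : ℝ × ℝ)) := by
  have hE : (fun g : E => ((inner ℝ g z, inner ℝ g x) : ℝ × ℝ)) =
      (innerSL ℝ z).prod (innerSL ℝ x) := by
    ext g <;> simp [real_inner_comm]
  have hF : (fun g : F => ((inner ℝ g w, inner ℝ g y) : ℝ × ℝ)) =
      (innerSL ℝ w).prod (innerSL ℝ y) := by
    ext g <;> simp [real_inner_comm]
  rw [hE, hF]
  have : IsProbabilityMeasure ((stdGaussian E).map ((innerSL ℝ z).prod (innerSL ℝ x))) :=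
    Measure.isProbabilityMeasure_map (by fun_prop)
  have : IsProbabilityMeasure ((stdGaussian F).map ((innerSL ℝ w).prod (innerSL ℝ y))) :=
    Measure.isProbabilityMeasure_map (by fun_prop)
  refine Measure.ext_of_charFunDual ?_
  ext l
  rw [charFunDual_map, charFunDual_map, charFunDual_stdGaussian, charFunDual_stdGaussian]
  have e1 : l ∘L (innerSL ℝ z).prod (innerSL ℝ x) = innerSL ℝ (l (1, 0) • z + l (0, 1) • x) := by
    ext g
    have : ((inner ℝ z g, inner ℝ x g) : ℝ × ℝ) =
        inner ℝ z g • ((1, 0) : ℝ × ℝ) + inner ℝ x g • ((0, 1) : ℝ × ℝ) := by ext <;> simp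
    simp only [ContinuousLinearMap.comp_apply, ContinuousLinearMap.prod_apply, innerSL_apply_apply]
    rw [this, map_add, map_smul, map_smul, inner_add_left, inner_smul_left, inner_smul_left]
    simp [mul_comm]
  have e2 : l ∘L (innerSL ℝ w).prod (innerSL ℝ y) = innerSL ℝ (l (1, 0) • w + l (0, 1) • y) := by
    ext g
    have : ((inner ℝ w g, inner ℝ y g) : ℝ × ℝ) =
        inner ℝ w g • ((1, 0) : ℝ × ℝ) + inner ℝ y g • ((0, 1) : ℝ × ℝ) := by ext <;> simp
    simp only [ContinuousLinearMap.comp_apply, ContinuousLinearMap.prod_apply, innerSL_apply_apply]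
    rw [this, map_add, map_smul, map_smul, inner_add_left, inner_smul_left, inner_smul_left]
    simp [mul_comm]
  rw [e1, e2, innerSL_apply_norm, innerSL_apply_norm, h.norm_comb]

lemma SameGram.integral_eq {z x : E} {w y : F} (h : SameGram z x w y) {Φ : ℝ → ℝ → ℝ}
    (hΦ : Measurable (Function.uncurry Φ)) :
    ∫ g, Φ (inner ℝ g z) (inner ℝ g x) ∂stdGaussian E =
      ∫ g, Φ (inner ℝ g w) (inner ℝ g y) ∂stdGaussian F := by
  have h1 := integral_map (μ := stdGaussian E) (measurable_inner_pair z x).aemeasurable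
    (f := Function.uncurry Φ) hΦ.aestronglyMeasurable
  have h2 := integral_map (μ := stdGaussian F) (measurable_inner_pair w y).aemeasurable
    (f := Function.uncurry Φ) hΦ.aestronglyMeasurable
  rw [h.map_eq, h2] at h1
  exact h1.symm

lemma SameGram.integrable_iff {z x : E} {w y : F} (h : SameGram z x w y) {Φ : ℝ → ℝ → ℝ}
    (hΦ : Measurable (Function.uncurry Φ)) :
    Integrable (fun g => Φ (inner ℝ g z) (inner ℝ g x)) (stdGaussian E) ↔
      Integrable (fun g => Φ (inner ℝ g w) (inner ℝ g y)) (stdGaussian F) := by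
  have h1 := integrable_map_measure (μ := stdGaussian E) (g := Function.uncurry Φ)
    hΦ.aestronglyMeasurable (measurable_inner_pair z x).aemeasurable
  have h2 := integrable_map_measure (μ := stdGaussian F) (g := Function.uncurry Φ)
    hΦ.aestronglyMeasurable (measurable_inner_pair w y).aemeasurable
  rw [h.map_eq, h2] at h1
  exact h1.symm

lemma integral_sq_inner (w : E) : ∫ g, inner ℝ g w ^ 2 ∂stdGaussian E = ‖w‖ ^ 2 := by
  have h := variance_dual_stdGaussian (innerSL ℝ w)
  rw [variance_of_integral_eq_zero (by fun_prop) (integral_strongDual_stdGaussian _),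
    innerSL_apply_norm] at h
  simpa [real_inner_comm] using h

lemma integrable_sq_inner (w : E) : Integrable (fun g => inner ℝ g w ^ 2) (stdGaussian E) := by
  have h : MemLp (innerSL ℝ w : E → ℝ) 2 (stdGaussian E) :=
    (innerSL ℝ w).comp_memLp' (IsGaussian.memLp_id (stdGaussian E) 2 (by simp))
  simpa [real_inner_comm] using h.integrable_sq

lemma ae_inner_ne_zero {w : E} (hw : w ≠ 0) : ∀ᵐ g ∂stdGaussian E, inner ℝ g w ≠ 0 := by
  have hmap := IsGaussian.map_eq_gaussianReal (μ := stdGaussian E) (innerSL ℝ w)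
  have hv := variance_dual_stdGaussian (innerSL ℝ w)
  rw [hv, innerSL_apply_norm] at hmap
  have hne : (‖w‖ ^ 2).toNNReal ≠ 0 := by
    have := norm_pos_iff.2 hw
    simp only [ne_eq, Real.toNNReal_eq_zero, not_le]; positivity
  have := nullSingletonClass_gaussianReal (μ := (stdGaussian E)[innerSL ℝ w]) hne
  have h0 : ∀ᵐ y ∂((stdGaussian E).map (innerSL ℝ w)), y ≠ 0 := by
    rw [hmap]
    exact Measure.ae_ne _ 0
  have := ae_of_ae_map (by fun_prop) h0
  filter_upwards [this] with g hg
  simpa [real_inner_comm] using hg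

end Gram

/-! ### Functions of quadratic growth and their Gaussian expectations -/

/-- Functions of two real variables of quadratic growth that are locally Lipschitz in the first
variable with a linearly growing constant. -/
structure QuadLip (L : ℝ) (Φ : ℝ → ℝ → ℝ) : Prop where
  meas : Measurable (Function.uncurry Φ)
  bound : ∀ u v, |Φ u v| ≤ L * (u ^ 2 + v ^ 2)
  lip : ∀ u u' v, |Φ u v - Φ u' v| ≤ L * (|u - u'| * (|u| + |u'| + |v|))

lemma QuadLip.nonneg {L : ℝ} {Φ : ℝ → ℝ → ℝ} (h : QuadLip L Φ) : 0 ≤ L := by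
  simpa using (abs_nonneg _).trans (h.bound 1 0)

/-- Young's inequality turns the products into squares, whose expectations are exact and whose
sample sums are controlled by the operator norm. For `z`, `z'` at distance `η` both terms are of
order `η`. -/
lemma QuadLip.abs_sub_le {L : ℝ} {Φ : ℝ → ℝ → ℝ} (h : QuadLip L Φ) {η : ℝ} (hη : 0 < η)
    (u u' v : ℝ) :
    |Φ u v - Φ u' v| ≤ L / 2 * (3 / η * (u - u') ^ 2 + η * (u ^ 2 + u' ^ 2 + v ^ 2)) := by
  have key : ∀ p q : ℝ, |p| * |q| ≤ (1 / η * p ^ 2 + η * q ^ 2) / 2 := by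
    intro p q
    have : 0 ≤ (|p| - η * |q|) ^ 2 / η := by positivity
    have e : (|p| - η * |q|) ^ 2 / η = 1 / η * |p| ^ 2 - 2 * (|p| * |q|) + η * |q| ^ 2 := by
      field_simp
      ring
    rw [e, sq_abs, sq_abs] at this
    linarith
  refine (h.lip u u' v).trans ?_
  have h1 := key (u - u') u
  have h2 := key (u - u') u'
  have h3 := key (u - u') v
  calc L * (|u - u'| * (|u| + |u'| + |v|)) ≤
      L * ((1 / η * (u - u') ^ 2 + η * u ^ 2) / 2 + (1 / η * (u - u') ^ 2 + η * u' ^ 2) / 2 +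
        (1 / η * (u - u') ^ 2 + η * v ^ 2) / 2) :=
        mul_le_mul_of_nonneg_left (by linarith) h.nonneg
    _ = _ := by ring

/-- The expectation of `Φ(⟪g, z⟫, ⟪g, x⟫)` for a standard Gaussian vector `g`. -/
noncomputable def pop {E : Type*} [NormedAddCommGroup E] [InnerProductSpace ℝ E]
    [FiniteDimensional ℝ E] [MeasurableSpace E] (Φ : ℝ → ℝ → ℝ) (z x : E) : ℝ :=
  ∫ g, Φ (inner ℝ g z) (inner ℝ g x) ∂stdGaussian E

section Pop

variable {E : Type*} [NormedAddCommGroup E] [InnerProductSpace ℝ E] [FiniteDimensional ℝ E]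
  [MeasurableSpace E] [BorelSpace E] {L : ℝ} {Φ : ℝ → ℝ → ℝ}

lemma QuadLip.measurable_comp (h : QuadLip L Φ) (z x : E) :
    Measurable fun g : E => Φ (inner ℝ g z) (inner ℝ g x) :=
  h.meas.comp (measurable_inner_pair z x)

lemma QuadLip.integrable (h : QuadLip L Φ) (z x : E) :
    Integrable (fun g => Φ (inner ℝ g z) (inner ℝ g x)) (stdGaussian E) := by
  refine (((integrable_sq_inner z).add (integrable_sq_inner x)).const_mul L).mono'
    (h.measurable_comp z x).aestronglyMeasurable (ae_of_all _ fun g => ?_)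
  simpa using h.bound _ _

lemma QuadLip.abs_pop_sub_le (h : QuadLip L Φ) {R η : ℝ} (hη : 0 < η) {z z' x : E}
    (hz : ‖z‖ ≤ R) (hz' : ‖z'‖ ≤ R) (hx : ‖x‖ = 1) (hzz : ‖z - z'‖ ≤ η) :
    |pop Φ z x - pop Φ z' x| ≤ L * (η * (R ^ 2 + 2)) := by
  unfold pop
  rw [← integral_sub (h.integrable z x) (h.integrable z' x)]
  have hi1 := (integrable_sq_inner (z - z')).const_mul (3 / η)
  have hi3 : Integrable (fun g => inner ℝ g z ^ 2 + inner ℝ g z' ^ 2) (stdGaussian E) :=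
    (integrable_sq_inner z).add (integrable_sq_inner z')
  have hi2 : Integrable (fun g => η * (inner ℝ g z ^ 2 + inner ℝ g z' ^ 2 + inner ℝ g x ^ 2))
    (stdGaussian E) := (hi3.add (integrable_sq_inner x)).const_mul η
  have : ∫ g, L / 2 * (3 / η * inner ℝ g (z - z') ^ 2 + η * (inner ℝ g z ^ 2 + inner ℝ g z' ^ 2 +
      inner ℝ g x ^ 2)) ∂stdGaussian E = L / 2 * (3 / η * ‖z - z'‖ ^ 2 +
        η * (‖z‖ ^ 2 + ‖z'‖ ^ 2 + ‖x‖ ^ 2)) := by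
    rw [integral_const_mul, integral_add hi1 hi2, integral_const_mul, integral_const_mul,
      integral_add hi3 (integrable_sq_inner x),
      integral_add (integrable_sq_inner z) (integrable_sq_inner z')]
    simp only [integral_sq_inner]
  calc _ ≤ ∫ g, |Φ (inner ℝ g z) (inner ℝ g x) - Φ (inner ℝ g z') (inner ℝ g x)| ∂stdGaussian E :=
        abs_integral_le_integral_abs
    _ ≤ ∫ g, L / 2 * (3 / η * inner ℝ g (z - z') ^ 2 + η * (inner ℝ g z ^ 2 + inner ℝ g z' ^ 2 +
      inner ℝ g x ^ 2)) ∂stdGaussian E := by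
        refine integral_mono ((h.integrable z x).sub (h.integrable z' x)).abs
          ((hi1.add hi2).const_mul (L / 2)) fun g => ?_
        simpa [inner_sub_right] using h.abs_sub_le hη (inner ℝ g z) (inner ℝ g z') (inner ℝ g x)
    _ ≤ _ := by
        rw [this, hx]
        have h0 := h.nonneg
        have a1 : ‖z - z'‖ ^ 2 ≤ η ^ 2 := by gcongr
        have a2 : ‖z‖ ^ 2 ≤ R ^ 2 := by gcongr
        have a3 : ‖z'‖ ^ 2 ≤ R ^ 2 := by gcongr
        calc _ ≤ L / 2 * (3 / η * η ^ 2 + η * (R ^ 2 + R ^ 2 + 1 ^ 2)) := by gcongr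
          _ = _ := by field_simp; ring

lemma QuadLip.continuous_pop (h : QuadLip L Φ) {x : E} (hx : ‖x‖ = 1) :
    Continuous fun z : E => pop Φ z x := by
  rw [continuous_iff_continuousAt]
  intro z
  rw [Metric.continuousAt_iff]
  intro ε hε
  set R := ‖z‖ + 1
  set η := min 1 (ε / (2 * ((L + 1) * (R ^ 2 + 2)))) with hη
  have hL := h.nonneg
  have hη0 : 0 < η := by positivity
  refine ⟨η, hη0, fun {w} hw => ?_⟩
  rw [dist_eq_norm] at hw
  have hwR : ‖w‖ ≤ R := by
    have := norm_le_norm_add_norm_sub' w z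
    have := min_le_left 1 (ε / (2 * ((L + 1) * (R ^ 2 + 2))))
    linarith
  rw [Real.dist_eq]
  refine (h.abs_pop_sub_le hη0 hwR (by simp [R]) hx hw.le).trans_lt ?_
  have h1 : η ≤ ε / (2 * ((L + 1) * (R ^ 2 + 2))) := min_le_right _ _
  rw [le_div_iff₀ (by positivity)] at h1
  have : 0 ≤ η * (R ^ 2 + 2) := by positivity
  nlinarith

end Pop

/-! ### Exponential moments and nets -/

/-- Bound for the moment generating function of functions of quadratic growth, uniform in the
function. -/
lemma exists_mgf_le {E : Type*} [NormedAddCommGroup E] [InnerProductSpace ℝ E]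
    [FiniteDimensional ℝ E] [MeasurableSpace E] [BorelSpace E] (μ : Measure E) [IsGaussian μ]
    {K ε : ℝ} (hK : 0 < K) (hε : 0 < ε) :
    ∃ t > 0, ∀ Y : E → ℝ, Measurable Y → (∀ g, |Y g| ≤ K * ‖g‖ ^ 2) →
      Integrable (fun g => Real.exp (t * Y g)) μ ∧
        mgf Y μ t ≤ Real.exp (t * (∫ g, Y g ∂μ + ε)) := by
  obtain ⟨C, hC, hint⟩ := IsGaussian.exists_integrable_exp_sq μ
  set t₁ := C / (2 * K) with ht₁
  have ht₁0 : 0 < t₁ := by positivity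
  set M := 2 / t₁ ^ 2 * ∫ g, Real.exp (C * ‖g‖ ^ 2) ∂μ with hM
  have hM0 : 0 ≤ M := mul_nonneg (by positivity) (integral_nonneg fun g => (Real.exp_pos _).le)
  -- Being at most `t₁` makes `(tY)² exp |tY|` at most `t²` times a multiple of the integrable `exp
  -- (C‖g‖²)`; being at most `ε / (M + 1)` makes this second-order term cost at most `tε`.
  set t := min t₁ (ε / (M + 1)) with ht
  have ht0 : 0 < t := by positivity
  refine ⟨t, ht0, fun Y hY hYb => ?_⟩
  have htt : t ≤ t₁ := min_le_left _ _
  have htM : t * M ≤ ε := by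
    have : t ≤ ε / (M + 1) := min_le_right _ _
    rw [le_div_iff₀ (by positivity)] at this
    nlinarith
  have hab : ∀ g, |t * Y g| ≤ t₁ * (K * ‖g‖ ^ 2) := fun g => by
    rw [abs_mul, abs_of_pos ht0]
    exact mul_le_mul htt (hYb g) (abs_nonneg _) ht₁0.le
  have hKC : ∀ g : E, t₁ * (K * ‖g‖ ^ 2) = C * ‖g‖ ^ 2 / 2 := fun g => by
    rw [ht₁]; field_simp
  have hi : Integrable (fun g => Real.exp (t * Y g)) μ := by
    refine hint.mono' (by fun_prop) (ae_of_all _ fun g => ?_)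
    rw [Real.norm_eq_abs, Real.abs_exp, Real.exp_le_exp]
    have h1 := (le_abs_self _).trans (hab g)
    rw [hKC] at h1
    have : 0 ≤ C * ‖g‖ ^ 2 := by positivity
    linarith
  have hYi : Integrable Y μ := by
    refine (hint.const_mul (1 / t₁)).mono' hY.aestronglyMeasurable (ae_of_all _ fun g => ?_)
    rw [Real.norm_eq_abs]
    have h1 := hYb g
    have h2 := Real.add_one_le_exp (C * ‖g‖ ^ 2)
    have h3 : K * ‖g‖ ^ 2 = 1 / t₁ * (C * ‖g‖ ^ 2 / 2) := by rw [← hKC]; field_simp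
    rw [h3] at h1
    refine h1.trans (mul_le_mul_of_nonneg_left ?_ (by positivity))
    have : 0 ≤ C * ‖g‖ ^ 2 := by positivity
    linarith
  refine ⟨hi, ?_⟩
  have hi1 : Integrable (fun g => 1 + t * Y g) μ := (integrable_const 1).add (hYi.const_mul t)
  have hpt : ∀ g, Real.exp (t * Y g) ≤
      1 + t * Y g + t ^ 2 * (2 / t₁ ^ 2 * Real.exp (C * ‖g‖ ^ 2)) := fun g => by
    have h1 : Real.exp (t * Y g) ≤ 1 + t * Y g + (t * Y g) ^ 2 * Real.exp |t * Y g| := by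
      have := Complex.norm_exp_sub_sum_le_norm_mul_exp ((t * Y g : ℝ) : ℂ) 2
      simp only [Finset.sum_range_succ, Finset.sum_range_zero, zero_add, pow_zero, pow_one,
        Nat.factorial, Nat.cast_one, div_one, Nat.mul_one] at this
      rw [← Complex.ofReal_exp, ← Complex.ofReal_one, ← Complex.ofReal_add, ← Complex.ofReal_sub,
        Complex.norm_real, Complex.norm_real, Real.norm_eq_abs, Real.norm_eq_abs, sq_abs] at this
      linarith [le_abs_self (Real.exp (t * Y g) - (1 + t * Y g))]
    have h2 : (t * Y g) ^ 2 ≤ t ^ 2 * (2 / t₁ ^ 2 * Real.exp (C * ‖g‖ ^ 2 / 2)) := by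
      have a1 : (t₁ * (K * ‖g‖ ^ 2)) ^ 2 / 2 ≤ Real.exp (t₁ * (K * ‖g‖ ^ 2)) :=
        (Real.quadratic_le_exp_of_nonneg (by positivity)).trans' (by
          have : 0 ≤ t₁ * (K * ‖g‖ ^ 2) := by positivity
          linarith)
      have a2 : Y g ^ 2 ≤ (K * ‖g‖ ^ 2) ^ 2 := by
        rw [← sq_abs]
        exact pow_le_pow_left₀ (abs_nonneg _) (hYb g) 2
      rw [mul_pow]
      refine mul_le_mul_of_nonneg_left (a2.trans ?_) (by positivity)
      rw [← hKC]
      calc (K * ‖g‖ ^ 2) ^ 2 = 2 / t₁ ^ 2 * ((t₁ * (K * ‖g‖ ^ 2)) ^ 2 / 2) := by field_simp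
        _ ≤ _ := by gcongr
    have h3 : Real.exp |t * Y g| ≤ Real.exp (C * ‖g‖ ^ 2 / 2) := by
      rw [Real.exp_le_exp, ← hKC]; exact hab g
    have h4 : (t * Y g) ^ 2 * Real.exp |t * Y g| ≤
        t ^ 2 * (2 / t₁ ^ 2 * Real.exp (C * ‖g‖ ^ 2 / 2)) * Real.exp (C * ‖g‖ ^ 2 / 2) :=
      mul_le_mul h2 h3 (Real.exp_pos _).le (by positivity)
    have h5 : t ^ 2 * (2 / t₁ ^ 2 * Real.exp (C * ‖g‖ ^ 2 / 2)) * Real.exp (C * ‖g‖ ^ 2 / 2) =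
        t ^ 2 * (2 / t₁ ^ 2 * Real.exp (C * ‖g‖ ^ 2)) := by
      rw [mul_assoc, mul_assoc, ← Real.exp_add, add_halves]
    linarith
  calc mgf Y μ t = ∫ g, Real.exp (t * Y g) ∂μ := rfl
    _ ≤ ∫ g, (1 + t * Y g + t ^ 2 * (2 / t₁ ^ 2 * Real.exp (C * ‖g‖ ^ 2))) ∂μ :=
        integral_mono hi (hi1.add
          ((hint.const_mul _).const_mul _)) hpt
    _ = 1 + t * ∫ g, Y g ∂μ + t ^ 2 * M := by
        rw [integral_add hi1
          ((hint.const_mul _).const_mul _), integral_add (integrable_const 1) (hYi.const_mul t),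
          integral_const_mul, integral_const_mul, integral_const_mul]
        simp [hM]
    _ ≤ t * (∫ g, Y g ∂μ + ε) + 1 := by nlinarith
    _ ≤ _ := Real.add_one_le_exp _

section Net

open Metric Module

variable {E : Type*} [NormedAddCommGroup E] [NormedSpace ℝ E] [FiniteDimensional ℝ E]

/-- An `η`-separated set in the ball of radius `R` has at most `(2R/η + 1) ^ dim` elements. -/
lemma card_le_of_separated {R η : ℝ} (hR : 0 ≤ R) (hη : 0 < η) (s : Finset E)
    (hs : ∀ c ∈ s, ‖c‖ ≤ R) (h : ∀ c ∈ s, ∀ d ∈ s, c ≠ d → η ≤ ‖c - d‖) :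
    (s.card : ℝ) ≤ (2 * R / η + 1) ^ finrank ℝ E := by
  borelize E
  let μ : Measure E := Measure.addHaar
  have hη2 : 0 < η / 2 := by positivity
  have hρ : 0 < R + η / 2 := by positivity
  have D : Set.Pairwise (s : Set E) (Function.onFun Disjoint fun c => ball (c : E) (η / 2)) := by
    rintro c hc d hd hcd
    apply ball_disjoint_ball
    rw [dist_eq_norm, add_halves]
    exact h c hc d hd hcd
  -- Volume comparison: disjoint balls of radius `η/2` inside one of radius `R + η/2`.
  have hsub : ⋃ c ∈ s, ball (c : E) (η / 2) ⊆ ball (0 : E) (R + η / 2) := by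
    refine Set.iUnion₂_subset fun x hx => ball_subset_ball' ?_
    rw [dist_zero_right, add_comm]
    gcongr
    exact hs x hx
  have I : (s.card : ENNReal) * ENNReal.ofReal ((η / 2) ^ finrank ℝ E) * μ (ball 0 1) ≤
      ENNReal.ofReal ((R + η / 2) ^ finrank ℝ E) * μ (ball 0 1) :=
    calc
      (s.card : ENNReal) * ENNReal.ofReal ((η / 2) ^ finrank ℝ E) * μ (ball 0 1) =
          μ (⋃ c ∈ s, ball (c : E) (η / 2)) := by
        rw [measure_biUnion_finset D fun c _ => measurableSet_ball]
        simp only [μ.addHaar_ball_of_pos _ hη2, Finset.sum_const, nsmul_eq_mul, mul_assoc]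
      _ ≤ μ (ball (0 : E) (R + η / 2)) := measure_mono hsub
      _ = _ := by simp only [μ.addHaar_ball_of_pos _ hρ]
  have J := (ENNReal.mul_le_mul_iff_left (measure_ball_pos _ _ zero_lt_one).ne'
    measure_ball_lt_top.ne).1 I
  have K := ENNReal.toReal_le_of_le_ofReal (pow_nonneg hρ.le _) J
  rw [ENNReal.toReal_mul, ENNReal.toReal_natCast, ENNReal.toReal_ofReal (by positivity),
    ← le_div_iff₀ (by positivity), ← div_pow] at K
  have e : (R + η / 2) / (η / 2) = 2 * R / η + 1 := by field_simp
  rwa [e] at K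

/-- A separated set of maximal cardinality is a net, since any uncovered point could be added to it.
-/
lemma exists_net {R η : ℝ} (hR : 0 ≤ R) (hη : 0 < η) :
    ∃ T : Finset E, (T.card : ℝ) ≤ (2 * R / η + 1) ^ finrank ℝ E ∧ (∀ t ∈ T, ‖t‖ ≤ R) ∧
      ∀ z : E, ‖z‖ ≤ R → ∃ t ∈ T, ‖z - t‖ ≤ η := by
  classical
  let S : Set ℕ := {k | ∃ s : Finset E, s.card = k ∧ (∀ c ∈ s, ‖c‖ ≤ R) ∧
    ∀ c ∈ s, ∀ d ∈ s, c ≠ d → η ≤ ‖c - d‖}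
  have hne : S.Nonempty := ⟨0, ∅, by simp⟩
  have hbdd : BddAbove S := by
    refine ⟨⌊(2 * R / η + 1) ^ finrank ℝ E⌋₊, ?_⟩
    rintro k ⟨s, rfl, h1, h2⟩
    exact Nat.le_floor (card_le_of_separated hR hη s h1 h2)
  obtain ⟨T, hT, h1, h2⟩ := Nat.sSup_mem hne hbdd
  refine ⟨T, card_le_of_separated hR hη T h1 h2, h1, fun z hz => ?_⟩
  by_contra! hcon
  have hzT : z ∉ T := fun hmem => by simpa using (hη.trans (hcon z hmem))
  have : T.card + 1 ∈ S := by
    refine ⟨insert z T, Finset.card_insert_of_notMem hzT, ?_, ?_⟩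
    · intro c hc
      rcases Finset.mem_insert.1 hc with rfl | hc
      exacts [hz, h1 c hc]
    · intro c hc d hd hcd
      rcases Finset.mem_insert.1 hc with rfl | hc' <;>
        rcases Finset.mem_insert.1 hd with rfl | hd'
      · exact absurd rfl hcd
      · exact (hcon d hd').le
      · rw [norm_sub_rev]; exact (hcon c hc').le
      · exact h2 c hc' d hd' hcd
  have := le_csSup hbdd this
  omega

end Net

/-! ### Rare events and uniform concentration -/

/-- The law of `m` independent standard Gaussian vectors in `ℝⁿ`. -/
noncomputable abbrev gaussianSample (n m : ℕ) : Measure (Fin m → EuclideanSpace ℝ (Fin n)) :=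
  Measure.pi fun _ => stdGaussian (EuclideanSpace ℝ (Fin n))

/-- Events, for a sample of `m` Gaussian vectors and a unit vector `x` in `ℝⁿ`, whose probability
is at most `c exp (-δ m)` as soon as `m ≥ C n`. -/
def Rare (B : (n m : ℕ) → EuclideanSpace ℝ (Fin n) → (Fin m → EuclideanSpace ℝ (Fin n)) → Prop) :
    Prop :=
  ∃ C c δ : ℝ, 0 < C ∧ 0 < c ∧ 0 < δ ∧ ∀ n m : ℕ, 0 < m → C * n ≤ m →
    ∀ x : EuclideanSpace ℝ (Fin n), ‖x‖ = 1 →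
      gaussianSample n m {a | B n m x a} ≤ ENNReal.ofReal (c * Real.exp (-δ * m))

section Rare

variable {B B' : (n m : ℕ) → EuclideanSpace ℝ (Fin n) → (Fin m → EuclideanSpace ℝ (Fin n)) → Prop}

lemma Rare.mono (h : Rare B)
    (hB : ∀ n m x a, 0 < m → ‖x‖ = 1 → B' n m x a → B n m x a) : Rare B' := by
  obtain ⟨C, c, δ, hC, hc, hδ, h⟩ := h
  exact ⟨C, c, δ, hC, hc, hδ, fun n m hm hnm x hx =>
    (measure_mono fun a ha => hB n m x a hm hx ha).trans (h n m hm hnm x hx)⟩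

lemma rare_false : Rare fun _ _ _ _ => False :=
  ⟨1, 1, 1, one_pos, one_pos, one_pos, fun n m _ _ x _ => by simp⟩

lemma Rare.or (h : Rare B) (h' : Rare B') : Rare fun n m x a => B n m x a ∨ B' n m x a := by
  obtain ⟨C, c, δ, hC, hc, hδ, h⟩ := h
  obtain ⟨C', c', δ', hC', hc', hδ', h'⟩ := h'
  refine ⟨max C C', c + c', min δ δ', by positivity, by positivity, by positivity,
    fun n m hm hnm x hx => ?_⟩
  have h1 := h n m hm (hnm.trans' (by gcongr; exact le_max_left _ _)) x hx
  have h2 := h' n m hm (hnm.trans' (by gcongr; exact le_max_right _ _)) x hx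
  rw [Set.ofPred_or]
  refine (measure_union_le _ _).trans ((add_le_add h1 h2).trans ?_)
  rw [← ENNReal.ofReal_add (by positivity) (by positivity), add_mul]
  refine ENNReal.ofReal_le_ofReal (add_le_add ?_ ?_) <;> gcongr
  exacts [min_le_left _ _, min_le_right _ _]

/-- Union bound over sets of exponential size. -/
lemma rare_exists_mem {N δ : ℝ} (hN : 1 ≤ N) (hδ : 0 < δ)
    (T : (n : ℕ) → Finset (EuclideanSpace ℝ (Fin n))) (hT : ∀ n, ((T n).card : ℝ) ≤ N ^ n)
    (B : (n m : ℕ) → EuclideanSpace ℝ (Fin n) → EuclideanSpace ℝ (Fin n) →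
      (Fin m → EuclideanSpace ℝ (Fin n)) → Prop)
    (hB : ∀ n m x, ‖x‖ = 1 → ∀ t ∈ T n,
      gaussianSample n m {a | B n m x t a} ≤ ENNReal.ofReal (Real.exp (-δ * m))) :
    Rare fun n m x a => ∃ t ∈ T n, B n m x t a := by
  have hlog : 0 ≤ Real.log N := Real.log_nonneg hN
  -- With this ratio of `m` to `n`, the entropy `n log N` consumes at most half of the exponent `δ
  -- m`.
  refine ⟨2 * Real.log N / δ + 1, 1, δ / 2, by positivity, one_pos, by positivity,
    fun n m hm hnm x hx => ?_⟩
  have e : {a : Fin m → EuclideanSpace ℝ (Fin n) | ∃ t ∈ T n, B n m x t a} =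
      ⋃ t ∈ T n, {a | B n m x t a} := by ext; simp
  rw [e]
  refine (measure_biUnion_finset_le _ _).trans ((Finset.sum_le_sum (hB n m x hx)).trans ?_)
  rw [Finset.sum_const, nsmul_eq_mul, ← ENNReal.ofReal_natCast, ← ENNReal.ofReal_mul (by positivity)]
  refine ENNReal.ofReal_le_ofReal ?_
  have h1 : N ^ n = Real.exp (n * Real.log N) := by
    rw [Real.exp_nat_mul, Real.exp_log (by linarith)]
  have h2 : n * Real.log N ≤ δ / 2 * m := by
    have : 2 * Real.log N / δ * n ≤ m := by
      have : (0 : ℝ) ≤ n := by positivity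
      linarith
    have : δ / 2 * (2 * Real.log N / δ * n) ≤ δ / 2 * m := by gcongr
    calc n * Real.log N = δ / 2 * (2 * Real.log N / δ * n) := by field_simp
      _ ≤ _ := this
  calc ((T n).card : ℝ) * Real.exp (-δ * m) ≤ Real.exp (n * Real.log N) * Real.exp (-δ * m) := by
        rw [← h1]; gcongr; exact hT n
    _ = Real.exp (n * Real.log N + -δ * m) := (Real.exp_add _ _).symm
    _ ≤ 1 * Real.exp (-(δ / 2) * m) := by
        rw [one_mul, Real.exp_le_exp]; linarith

end Rare

/-- Exponential lower tail bound for sums `∑ Φ(⟪aᵢ, z⟫, ⟪aᵢ, x⟫)` at fixed `z` and `x`. -/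
lemma exists_tail_bound {L : ℝ} {Φ : ℝ → ℝ → ℝ} (h : QuadLip L Φ) {R ε : ℝ} (hε : 0 < ε) :
    ∃ δ > 0, ∀ (n m : ℕ) (z x : EuclideanSpace ℝ (Fin n)), ‖z‖ ≤ R → ‖x‖ = 1 →
      gaussianSample n m {a | ∑ i, Φ (inner ℝ (a i) z) (inner ℝ (a i) x) ≤ m * (pop Φ z x - ε)} ≤
        ENNReal.ofReal (Real.exp (-δ * m)) := by
  have hL := h.nonneg
  -- The Chernoff parameter is fixed in the plane, before `n` is known, and transported by equality
  -- of Gram matrices. The moment bound loses `ε / 2`, leaving the rate `t * (ε / 2)`.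
  obtain ⟨t, ht, hmgf⟩ := exists_mgf_le (stdGaussian (EuclideanSpace ℝ (Fin 2)))
    (K := L * (R ^ 2 + 1) + 1) (by positivity) (half_pos hε)
  refine ⟨t * (ε / 2), by positivity, fun n m z x hz hx => ?_⟩
  obtain ⟨ζ, hζ⟩ := exists_sameGram z x hx
  obtain ⟨hint, hle⟩ := hmgf (fun g => -Φ (inner ℝ g ζ) (inner ℝ g e₀)) (h.measurable_comp _ _).neg
    (fun g => by
      rw [abs_neg]
      refine (h.bound _ _).trans ?_
      have h1 : (inner ℝ g ζ) ^ 2 ≤ ‖g‖ ^ 2 * R ^ 2 := by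
        rw [← sq_abs, ← mul_pow]
        refine pow_le_pow_left₀ (abs_nonneg _) ((abs_real_inner_le_norm g ζ).trans ?_) 2
        rw [← hζ.norm_left]; gcongr
      have h2 : (inner ℝ g e₀) ^ 2 ≤ ‖g‖ ^ 2 := by
        rw [← sq_abs]
        refine pow_le_pow_left₀ (abs_nonneg _) ((abs_real_inner_le_norm g e₀).trans ?_) 2
        rw [norm_e₀, mul_one]
      calc L * (inner ℝ g ζ ^ 2 + inner ℝ g e₀ ^ 2) ≤ L * (‖g‖ ^ 2 * R ^ 2 + ‖g‖ ^ 2) := by gcongr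
        _ ≤ _ := by nlinarith [sq_nonneg ‖g‖])
  have hexp : Measurable (Function.uncurry fun u v => Real.exp (t * -Φ u v)) :=
    (h.meas.neg.const_mul t).exp
  have hint' := (hζ.integrable_iff (Φ := fun u v => Real.exp (t * -Φ u v)) hexp).2 hint
  have hmgf' : mgf (fun g => -Φ (inner ℝ g z) (inner ℝ g x)) (stdGaussian _) t ≤
      Real.exp (t * (-pop Φ z x + ε / 2)) := by
    have e1 := hζ.integral_eq (Φ := fun u v => Real.exp (t * -Φ u v)) hexp
    have e2 := hζ.integral_eq h.meas
    rw [integral_neg, ← e2] at hle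
    rw [mgf, e1]
    exact hle
  have hY : Measurable fun g => -Φ (inner ℝ g z) (inner ℝ g x) := (h.measurable_comp z x).neg
  have hind : iIndepFun (fun (i : Fin m) (a : Fin m → EuclideanSpace ℝ (Fin n)) =>
      -Φ (inner ℝ (a i) z) (inner ℝ (a i) x)) (gaussianSample n m) :=
    iIndepFun_pi (X := fun _ g => -Φ (inner ℝ g z) (inner ℝ g x)) fun _ => hY.aemeasurable
  have hmeas : ∀ i : Fin m, Measurable fun a : Fin m → EuclideanSpace ℝ (Fin n) =>
      -Φ (inner ℝ (a i) z) (inner ℝ (a i) x) := fun i => hY.comp (measurable_pi_apply i)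
  have hmp : ∀ i : Fin m, MeasurePreserving (Function.eval i) (gaussianSample n m)
      (stdGaussian (EuclideanSpace ℝ (Fin n))) := fun i => measurePreserving_eval _ i
  have hmgf_i : ∀ i : Fin m, mgf (fun a : Fin m → EuclideanSpace ℝ (Fin n) =>
      -Φ (inner ℝ (a i) z) (inner ℝ (a i) x)) (gaussianSample n m) t ≤
      Real.exp (t * (-pop Φ z x + ε / 2)) := fun i => by
    refine le_of_eq_of_le ?_ hmgf'
    rw [mgf, mgf, ← (hmp i).map_eq, integral_map (hmp i).measurable.aemeasurable
      (by exact ((hY.const_mul t).exp).aestronglyMeasurable)]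
  have hint_i : ∀ i : Fin m, Integrable (fun a : Fin m → EuclideanSpace ℝ (Fin n) =>
      Real.exp (t * -Φ (inner ℝ (a i) z) (inner ℝ (a i) x))) (gaussianSample n m) := fun i =>
    (hmp i).integrable_comp_of_integrable hint'
  have hsum_int := hind.integrable_exp_mul_sum hmeas (s := Finset.univ) fun i _ => hint_i i
  have hch := measure_ge_le_exp_mul_mgf (m * (-pop Φ z x + ε)) ht.le hsum_int
  rw [hind.mgf_sum hmeas] at hch
  have hprod : ∏ i : Fin m, mgf (fun a : Fin m → EuclideanSpace ℝ (Fin n) =>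
      -Φ (inner ℝ (a i) z) (inner ℝ (a i) x)) (gaussianSample n m) t ≤
      Real.exp (m * (t * (-pop Φ z x + ε / 2))) := by
    refine (Finset.prod_le_prod (fun i _ => mgf_nonneg) fun i _ => hmgf_i i).trans ?_
    simp [Real.exp_nat_mul]
  have hfin := hch.trans (mul_le_mul_of_nonneg_left hprod (Real.exp_pos _).le)
  rw [← Real.exp_add] at hfin
  have hset : {a : Fin m → EuclideanSpace ℝ (Fin n) |
      ∑ i, Φ (inner ℝ (a i) z) (inner ℝ (a i) x) ≤ m * (pop Φ z x - ε)} =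
      {a | m * (-pop Φ z x + ε) ≤ (∑ i : Fin m, fun a : Fin m → EuclideanSpace ℝ (Fin n) =>
        -Φ (inner ℝ (a i) z) (inner ℝ (a i) x)) a} := by
    ext a
    simp only [Set.mem_ofPred_eq, Finset.sum_apply, Finset.sum_neg_distrib]
    constructor <;> intro h <;> linarith
  rw [hset, ← ofReal_measureReal]
  refine ENNReal.ofReal_le_ofReal (hfin.trans (Real.exp_le_exp.2 (le_of_eq ?_)))
  ring

/-- The sign turns the lower tail bound into an upper bound for `∑ ⟪aᵢ, t⟫²`. -/
lemma quadLip_neg_sq : QuadLip 1 fun u _ => -u ^ 2 where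
  meas := by unfold Function.uncurry; fun_prop
  bound u v := by
    rw [abs_neg, abs_of_nonneg (by positivity)]; nlinarith [sq_nonneg v]
  lip u u' v := by
    have : -u ^ 2 - -u' ^ 2 = -((u - u') * (u + u')) := by ring
    rw [this, abs_neg, abs_mul, one_mul]
    gcongr
    linarith [abs_add_le u u', abs_nonneg v]

/-- The operator norm of a Gaussian sample is of order `√m`. -/
lemma rare_large_norm : Rare fun _ m _ a => ¬ ∀ z, ∑ i, inner ℝ (a i) z ^ 2 ≤ 8 * m * ‖z‖ ^ 2 := by
  obtain ⟨δ, hδ, htail⟩ := exists_tail_bound quadLip_neg_sq (R := 1) one_pos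
  choose T hTc hTn hTz using fun n : ℕ =>
    exists_net (E := EuclideanSpace ℝ (Fin n)) zero_le_one (show (0 : ℝ) < 1 / 2 by norm_num)
  refine (rare_exists_mem (N := 5) (by norm_num) hδ T (fun n => (hTc n).trans (by norm_num)) (fun n m x t a =>
    ∑ i, -(inner ℝ (a i) t) ^ 2 ≤ m * (pop (fun u _ => -u ^ 2) t x - 1)) fun n m x hx t ht =>
      htail n m t x (hTn n t ht) hx).mono ?_
  intro n m x a hm hx hbad
  by_contra! hgood
  refine hbad fun z => ?_
  have hT : ∀ t ∈ T n, ∑ i, inner ℝ (a i) t ^ 2 ≤ 2 * m := by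
    intro t ht
    have h1 := hgood t ht
    have h2 : pop (fun u _ => -u ^ 2) t x = -‖t‖ ^ 2 := by
      rw [pop, integral_neg, integral_sq_inner]
    rw [h2, Finset.sum_neg_distrib] at h1
    have h3 : ‖t‖ ^ 2 ≤ 1 := pow_le_one₀ (norm_nonneg _) (hTn n t ht)
    have : (0 : ℝ) ≤ m := by positivity
    nlinarith
  set S : EuclideanSpace ℝ (Fin n) → ℝ := fun z => ∑ i, inner ℝ (a i) z ^ 2 with hS
  have hSsmul : ∀ (r : ℝ) w, S (r • w) = r ^ 2 * S w := fun r w => by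
    simp only [hS, inner_smul_right, mul_pow, Finset.mul_sum]
  -- At a maximizer `w` with net point `t`, homogeneity gives `S (w - t) ≤ S w / 4`. Then `S w ≤ 2 S
  -- t + S w / 2`, so the bound `2m` on the net becomes `8m` on the ball.
  obtain ⟨w, hw, hmax⟩ := (isCompact_closedBall (0 : EuclideanSpace ℝ (Fin n)) 1).exists_isMaxOn
    ⟨0, by simp⟩ (f := S) (by fun_prop)
  rw [mem_closedBall_zero_iff] at hw
  have hball : ∀ y, ‖y‖ ≤ 1 → S y ≤ S w := fun y hy => hmax (by simpa using hy)
  obtain ⟨t, ht, hwt⟩ := hTz n w hw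
  have h1 : S w ≤ 2 * S t + 2 * S (w - t) := by
    simp only [hS, Finset.mul_sum, ← Finset.sum_add_distrib]
    refine Finset.sum_le_sum fun i _ => ?_
    rw [inner_sub_right]
    nlinarith [sq_nonneg (inner ℝ (a i) t - (inner ℝ (a i) w - inner ℝ (a i) t))]
  have h2 : 4 * S (w - t) ≤ S w := by
    have := hball ((2 : ℝ) • (w - t)) (by rw [norm_smul]; norm_num; linarith)
    rw [hSsmul] at this
    linarith
  have h3 : S w ≤ 8 * m := by linarith [hT t ht]
  rcases eq_or_ne z 0 with rfl | hz
  · simp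
  have hz' : 0 < ‖z‖ := norm_pos_iff.2 hz
  have h4 := hball (‖z‖⁻¹ • z) (by rw [norm_smul, norm_inv, norm_norm, inv_mul_cancel₀ hz'.ne'])
  rw [hSsmul, inv_pow, inv_mul_le_iff₀ (by positivity)] at h4
  change S z ≤ _
  nlinarith [sq_nonneg ‖z‖]

/-- Uniform lower bound for `∑ Φ(⟪aᵢ, z⟫, ⟪aᵢ, x⟫)` over a ball of vectors `z`. -/
theorem rare_sum_le_pop {L : ℝ} {Φ : ℝ → ℝ → ℝ} (h : QuadLip L Φ) {R ε : ℝ} (hR : 0 ≤ R)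
    (hε : 0 < ε) :
    Rare fun _ m x a => ∃ z, ‖z‖ ≤ R ∧
      ∑ i, Φ (inner ℝ (a i) z) (inner ℝ (a i) x) ≤ m * (pop Φ z x - ε) := by
  have hL := h.nonneg
  obtain ⟨δ, hδ, htail⟩ := exists_tail_bound h (R := R) (half_pos hε)
  -- Moving to the net costs `Lη(R² + 2)` in expectation and, per sample vector, 8 times as much in
  -- the sum; the total factor 9 must stay below `ε / 2`.
  set η : ℝ := ε / (18 * (L + 1) * (R ^ 2 + 2)) with hη
  have hη0 : 0 < η := by positivity
  have hηε : 9 * (L * (η * (R ^ 2 + 2))) < ε / 2 := by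
    have : 9 * ((L + 1) * (η * (R ^ 2 + 2))) = ε / 2 := by rw [hη]; field_simp; norm_num
    have : 0 < η * (R ^ 2 + 2) := by positivity
    nlinarith
  choose T hTc hTn hTz using fun n : ℕ => exists_net (E := EuclideanSpace ℝ (Fin n)) hR hη0
  have hnet := rare_exists_mem (N := 2 * R / η + 1) (by have : 0 ≤ 2 * R / η := by positivity
                                                        linarith) hδ T
    (fun n => (hTc n).trans (by simp)) (fun n m x t a =>
      ∑ i, Φ (inner ℝ (a i) t) (inner ℝ (a i) x) ≤ m * (pop Φ t x - ε / 2)) fun n m x hx t ht =>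
      htail n m t x (hTn n t ht) hx
  refine (hnet.or rare_large_norm).mono ?_
  rintro n m x a hm hx ⟨z, hz, hbad⟩
  by_contra! hgood
  obtain ⟨hg1, hg2⟩ := hgood
  obtain ⟨t, ht, hzt⟩ := hTz n z hz
  have htR := hTn n t ht
  have h1 := hg1 t ht
  have h2 := abs_le.1 (h.abs_pop_sub_le hη0 hz htR hx hzt)
  have hm' : (0 : ℝ) < m := by exact_mod_cast hm
  have h3 : ∑ i, Φ (inner ℝ (a i) t) (inner ℝ (a i) x) - ∑ i, Φ (inner ℝ (a i) z) (inner ℝ (a i) x)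
      ≤ m * (8 * (L * (η * (R ^ 2 + 2)))) := by
    rw [← Finset.sum_sub_distrib]
    calc _ ≤ ∑ i, L / 2 * (3 / η * (inner ℝ (a i) (t - z)) ^ 2 + η * (inner ℝ (a i) t ^ 2 +
          inner ℝ (a i) z ^ 2 + inner ℝ (a i) x ^ 2)) := by
          refine Finset.sum_le_sum fun i _ => (le_abs_self _).trans ?_
          rw [inner_sub_right]
          exact h.abs_sub_le hη0 _ _ _
      _ = L / 2 * (3 / η * ∑ i, (inner ℝ (a i) (t - z)) ^ 2 + η * (∑ i, inner ℝ (a i) t ^ 2 +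
          ∑ i, inner ℝ (a i) z ^ 2 + ∑ i, inner ℝ (a i) x ^ 2)) := by
          simp only [Finset.mul_sum, Finset.sum_add_distrib, mul_add]
      _ ≤ L / 2 * (3 / η * (8 * m * η ^ 2) + η * (8 * m * R ^ 2 + 8 * m * R ^ 2 + 8 * m * 1 ^ 2)) := by
          have a1 := (hg2 (t - z)).trans (b := 8 * m * ‖t - z‖ ^ 2) (c := 8 * m * η ^ 2) (by
            rw [norm_sub_rev]; gcongr)
          have a2 := (hg2 t).trans (b := 8 * m * ‖t‖ ^ 2) (c := 8 * m * R ^ 2) (by gcongr)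
          have a3 := (hg2 z).trans (b := 8 * m * ‖z‖ ^ 2) (c := 8 * m * R ^ 2) (by gcongr)
          have a4 := hg2 x
          rw [hx] at a4
          gcongr
      _ = _ := by field_simp; ring
  nlinarith

/-- If the expectation of `Φ` is positive at a point of the plane, then so are its empirical means
at all vectors with nearby Gram data, except on a rare event. -/
theorem exists_nhds_rare_sum_nonpos {L : ℝ} {Φ : ℝ → ℝ → ℝ} (h : QuadLip L Φ)
    {ζ₀ : EuclideanSpace ℝ (Fin 2)} (hpos : 0 < pop Φ ζ₀ e₀) :
    ∃ U ∈ 𝓝 ζ₀, Rare fun _ _ x a => ∃ z, ∃ ζ ∈ U, SameGram z x ζ e₀ ∧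
      ∑ i, Φ (inner ℝ (a i) z) (inner ℝ (a i) x) ≤ 0 := by
  have hc := (h.continuous_pop norm_e₀).tendsto ζ₀
  refine ⟨{ζ | pop Φ ζ₀ e₀ / 2 < pop Φ ζ e₀} ∩ Metric.ball ζ₀ 1,
    inter_mem (hc.eventually_const_lt (by linarith)) (Metric.ball_mem_nhds _ one_pos), ?_⟩
  refine (rare_sum_le_pop h (R := ‖ζ₀‖ + 1) (by positivity) (half_pos hpos)).mono ?_
  rintro n m x a hm hx ⟨z, ζ, ⟨h1, h2⟩, hg, hle⟩
  refine ⟨z, ?_, hle.trans ?_⟩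
  · rw [hg.norm_left]
    have := norm_le_norm_add_norm_sub' ζ ζ₀
    rw [mem_ball_iff_norm] at h2
    linarith
  · rw [show pop Φ z x = pop Φ ζ e₀ from hg.integral_eq h.meas]
    have : pop Φ ζ₀ e₀ / 2 < pop Φ ζ e₀ := h1
    exact mul_nonneg (by positivity) (by linarith)

/-! ### Lipschitz bounds for the functions in use -/

section Classes

variable {L M : ℝ} {f g Φ Ψ : ℝ → ℝ → ℝ}

/-- Lipschitz functions of two real variables vanishing at the origin. -/
structure LinLip (L : ℝ) (f : ℝ → ℝ → ℝ) : Prop where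
  nonneg : 0 ≤ L
  zero : f 0 0 = 0
  lip : ∀ u v u' v', |f u v - f u' v'| ≤ L * (|u - u'| + |v - v'|)

lemma LinLip.bound (h : LinLip L f) (u v : ℝ) : |f u v| ≤ L * (|u| + |v|) := by
  simpa [h.zero] using h.lip u v 0 0

lemma LinLip.continuous (h : LinLip L f) : Continuous (Function.uncurry f) := by
  refine (LipschitzWith.of_dist_le_mul (K := ⟨2 * L, by linarith [h.nonneg]⟩) fun p q => ?_).continuous
  rw [Real.dist_eq]
  refine (h.lip p.1 p.2 q.1 q.2).trans ?_
  have h1 : |p.1 - q.1| ≤ dist p q := by rw [← Real.dist_eq, Prod.dist_eq]; exact le_max_left _ _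
  have h2 : |p.2 - q.2| ≤ dist p q := by rw [← Real.dist_eq, Prod.dist_eq]; exact le_max_right _ _
  calc _ ≤ L * (dist p q + dist p q) := mul_le_mul_of_nonneg_left (add_le_add h1 h2) h.nonneg
    _ = 2 * L * dist p q := by ring

lemma linLip_fst : LinLip 1 fun u _ => u := ⟨zero_le_one, rfl, fun u v u' v' => by
  rw [one_mul]; linarith [abs_nonneg (v - v')]⟩

lemma linLip_snd : LinLip 1 fun _ v => v := ⟨zero_le_one, rfl, fun u v u' v' => by
  rw [one_mul]; linarith [abs_nonneg (u - u')]⟩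

lemma LinLip.abs (h : LinLip L f) : LinLip L fun u v => |f u v| :=
  ⟨h.nonneg, by simp [h.zero], fun u v u' v' => (abs_abs_sub_abs_le _ _).trans (h.lip u v u' v')⟩

lemma LinLip.mul (hf : LinLip L f) (hg : LinLip M g) :
    QuadLip (2 * (L * M)) fun u v => f u v * g u v where
  meas := (hf.continuous.mul hg.continuous).measurable
  bound u v := by
    rw [abs_mul]
    have hL := hf.nonneg
    have hM := hg.nonneg
    calc _ ≤ (L * (|u| + |v|)) * (M * (|u| + |v|)) :=
          mul_le_mul (hf.bound u v) (hg.bound u v) (abs_nonneg _) (by positivity)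
      _ = L * M * (|u| + |v|) ^ 2 := by ring
      _ ≤ L * M * (2 * (u ^ 2 + v ^ 2)) := by
          rw [← sq_abs u, ← sq_abs v]
          gcongr
          nlinarith [sq_nonneg (|u| - |v|)]
      _ = _ := by ring
  lip u u' v := by
    have hL := hf.nonneg
    have hM := hg.nonneg
    have e : f u v * g u v - f u' v * g u' v =
        f u v * (g u v - g u' v) + g u' v * (f u v - f u' v) := by ring
    rw [e]
    refine (abs_add_le _ _).trans ?_
    rw [abs_mul, abs_mul]
    have h1 : |f u v - f u' v| ≤ L * |u - u'| := by simpa using hf.lip u v u' v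
    have h2 : |g u v - g u' v| ≤ M * |u - u'| := by simpa using hg.lip u v u' v
    calc _ ≤ L * (|u| + |v|) * (M * |u - u'|) + M * (|u'| + |v|) * (L * |u - u'|) := by
          gcongr
          exacts [hf.bound u v, hg.bound u' v]
      _ = L * M * (|u - u'| * (|u| + |u'| + 2 * |v|)) := by ring
      _ ≤ L * M * (|u - u'| * (2 * (|u| + |u'| + |v|))) := by
          gcongr
          linarith [abs_nonneg u, abs_nonneg u']
      _ = _ := by ring

lemma QuadLip.add (hΦ : QuadLip L Φ) (hΨ : QuadLip M Ψ) :
    QuadLip (L + M) fun u v => Φ u v + Ψ u v where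
  meas := hΦ.meas.add hΨ.meas
  bound u v := (abs_add_le _ _).trans (by
    rw [add_mul]; exact add_le_add (hΦ.bound u v) (hΨ.bound u v))
  lip u u' v := by
    rw [add_sub_add_comm, add_mul]
    exact (abs_add_le _ _).trans (add_le_add (hΦ.lip u u' v) (hΨ.lip u u' v))

lemma QuadLip.const_mul (hΦ : QuadLip L Φ) (c : ℝ) : QuadLip (|c| * L) fun u v => c * Φ u v where
  meas := hΦ.meas.const_mul c
  bound u v := by
    rw [abs_mul, mul_assoc]
    exact mul_le_mul_of_nonneg_left (hΦ.bound u v) (abs_nonneg c)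
  lip u u' v := by
    rw [← mul_sub, abs_mul, mul_assoc]
    exact mul_le_mul_of_nonneg_left (hΦ.lip u u' v) (abs_nonneg c)

lemma QuadLip.max (hΦ : QuadLip L Φ) (hΨ : QuadLip M Ψ) :
    QuadLip (L + M) fun u v => max (Φ u v) (Ψ u v) where
  meas := hΦ.meas.max hΨ.meas
  bound u v := by
    have h1 := hΦ.bound u v
    have h2 := hΨ.bound u v
    have h3 : |Max.max (Φ u v) (Ψ u v)| ≤ |Φ u v| + |Ψ u v| :=
      abs_max_le_max_abs_abs.trans (max_le_add_of_nonneg (abs_nonneg _) (abs_nonneg _))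
    linarith
  lip u u' v := by
    have h1 := hΦ.lip u u' v
    have h2 := hΨ.lip u u' v
    have h3 := (abs_max_sub_max_le_max (Φ u v) (Ψ u v) (Φ u' v) (Ψ u' v)).trans
      (max_le_add_of_nonneg (abs_nonneg _) (abs_nonneg _))
    linarith

lemma QuadLip.min (hΦ : QuadLip L Φ) (hΨ : QuadLip M Ψ) :
    QuadLip (L + M) fun u v => min (Φ u v) (Ψ u v) where
  meas := hΦ.meas.min hΨ.meas
  bound u v := by
    have h1 := hΦ.bound u v
    have h2 := hΨ.bound u v
    have h3 : |Min.min (Φ u v) (Ψ u v)| ≤ |Φ u v| + |Ψ u v| :=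
      abs_min_le_max_abs_abs.trans (max_le_add_of_nonneg (abs_nonneg _) (abs_nonneg _))
    linarith
  lip u u' v := by
    have h1 := hΦ.lip u u' v
    have h2 := hΨ.lip u u' v
    have h3 := (abs_min_sub_min_le_max (Φ u v) (Ψ u v) (Φ u' v) (Ψ u' v)).trans
      (max_le_add_of_nonneg (abs_nonneg _) (abs_nonneg _))
    linarith

lemma quadLip_sq_fst : QuadLip (2 * (1 * 1)) fun u _ => u ^ 2 := by
  simpa [sq] using linLip_fst.mul linLip_fst

lemma quadLip_sq_snd : QuadLip (2 * (1 * 1)) fun _ v => v ^ 2 := by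
  simpa [sq] using linLip_snd.mul linLip_snd

lemma quadLip_zero : QuadLip 0 fun _ _ => 0 := by
  simpa using quadLip_sq_fst.const_mul 0

end Classes

lemma abs_clip_sub_le (hβ : 0 < β) (u v u' v' : ℝ) :
    |clip β u v - clip β u' v'| ≤ |u - u'| + β * |v - v'| := by
  have h0 : |β * |v| - (β * |v'|)| ≤ β * |v - v'| := by
    rw [← mul_sub, abs_mul, abs_of_pos hβ]
    exact mul_le_mul_of_nonneg_left (abs_abs_sub_abs_le v v') hβ.le
  have h0' : |-(β * |v|) - (-(β * |v'|))| ≤ β * |v - v'| := by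
    rwa [neg_sub_neg, abs_sub_comm]
  have h1 := abs_nonneg (u - u')
  have h2 : 0 ≤ β * |v - v'| := by positivity
  refine (abs_max_sub_max_le_max _ _ _ _).trans (max_le (by linarith) ?_)
  exact (abs_min_sub_min_le_max _ _ _ _).trans (max_le (by linarith) (by linarith))

lemma abs_clip_le (hβ : 0 < β) (u v : ℝ) : |clip β u v| ≤ β * |v| := by
  have : 0 ≤ β * |v| := by positivity
  rw [abs_le]
  exact ⟨le_max_left _ _, max_le (by linarith) (min_le_left _ _)⟩

/-- The Lipschitz constant of `slope β`. -/
noncomputable def slopeLip (β : ℝ) : ℝ := 2 + (2 / β + 1) * (1 + β) + (3 + 5 * β)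

/-- The only delicate term is the cubic quotient. With `r = w / v`, which stays in `[-β, β]` for the
clipped value `w`, it equals `r² w / β²`, and differences of `r` occur only multiplied by `v`. -/
lemma linLip_slope (hβ : 0 < β) : LinLip (slopeLip β) (slope β) := by
  refine ⟨by unfold slopeLip; positivity, by simp [slope_zero_right], fun u v u' v' => ?_⟩
  set w := clip β u v with hw
  set w' := clip β u' v' with hw'
  have hww := abs_clip_sub_le hβ u v u' v'
  rw [← hw, ← hw'] at hww
  have ratio : ∀ c y : ℝ, |c| ≤ β * |y| → c / y * y = c ∧ |c / y| ≤ β := by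
    intro c y hc
    rcases eq_or_ne y 0 with rfl | hy
    · have : c = 0 := by simpa using hc
      simp [this, hβ.le]
    · exact ⟨div_mul_cancel₀ _ hy, by rw [abs_div, div_le_iff₀ (abs_pos.2 hy)]; exact hc⟩
  obtain ⟨hr1, hr2⟩ := ratio w v (abs_clip_le hβ u v)
  obtain ⟨hr1', hr2'⟩ := ratio w' v' (abs_clip_le hβ u' v')
  obtain ⟨r, hr⟩ : ∃ r, r = w / v := ⟨_, rfl⟩
  obtain ⟨r', hr'⟩ : ∃ r, r = w' / v' := ⟨_, rfl⟩
  rw [← hr] at hr1 hr2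
  rw [← hr'] at hr1' hr2'
  have hcube : |w ^ 3 / (β ^ 2 * v ^ 2) - w' ^ 3 / (β ^ 2 * v' ^ 2)| ≤
      3 * |w - w'| + 2 * β * |v - v'| := by
    have e : w ^ 3 / (β ^ 2 * v ^ 2) - w' ^ 3 / (β ^ 2 * v' ^ 2) =
        (r ^ 2 * (w - w') + (r + r') * (r' * (r * (v' - v) + (w - w')))) / β ^ 2 := by
      have e1 : w ^ 3 / (β ^ 2 * v ^ 2) = r ^ 2 * w / β ^ 2 := by rw [hr]; ring
      have e2 : w' ^ 3 / (β ^ 2 * v' ^ 2) = r' ^ 2 * w' / β ^ 2 := by rw [hr']; ring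
      rw [e1, e2, ← sub_div]
      congr 1
      linear_combination (-(r + r') * r) * hr1' + (r + r') * r' * hr1
    rw [e, abs_div, abs_of_pos (by positivity : 0 < β ^ 2), div_le_iff₀ (by positivity)]
    refine (abs_add_le _ _).trans ?_
    rw [abs_mul, abs_mul, abs_mul, abs_pow]
    calc |r| ^ 2 * |w - w'| + |r + r'| * (|r'| * |r * (v' - v) + (w - w')|) ≤
        β ^ 2 * |w - w'| + (β + β) * (β * (β * |v' - v| + |w - w'|)) := by
          have h1 : |r + r'| ≤ β + β := (abs_add_le _ _).trans (add_le_add hr2 hr2')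
          have h2 : |r * (v' - v) + (w - w')| ≤ β * |v' - v| + |w - w'| := by
            refine (abs_add_le _ _).trans ?_
            rw [abs_mul]; gcongr
          gcongr
      _ = _ := by rw [abs_sub_comm v' v]; ring
  have e : slope β u v - slope β u' v' = 2 * (u - u') + -((2 / β + 1) * (w - w')) +
      (w ^ 3 / (β ^ 2 * v ^ 2) - w' ^ 3 / (β ^ 2 * v' ^ 2)) := by
    simp only [slope, ← hw, ← hw']; ring
  rw [e]
  refine (abs_add_three _ _ _).trans ?_
  rw [abs_mul, abs_neg, abs_mul, abs_of_pos (by norm_num : (0 : ℝ) < 2),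
    abs_of_pos (by positivity : 0 < 2 / β + 1)]
  have h1 := abs_nonneg (u - u')
  have h2 := abs_nonneg (v - v')
  have h3 : (2 / β + 1) * |w - w'| ≤ (2 / β + 1) * ((1 + β) * (|u - u'| + |v - v'|)) := by
    gcongr
    nlinarith
  unfold slopeLip
  nlinarith

lemma quadLip_curvBound (β : ℝ) (k : ℕ) : ∃ L, QuadLip L (curvBound β k) := by
  have h := (quadLip_sq_snd.const_mul 2).min (((quadLip_sq_fst.const_mul (3 / β ^ 2)).add
    (quadLip_sq_snd.const_mul (1 - 2 / β))).add (((quadLip_sq_fst.add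
    (quadLip_sq_snd.const_mul (-((1 - 1 / (k + 1)) * β ^ 2)))).max quadLip_zero).const_mul
      ((k + 1) * (2 / β - 2) / β ^ 2)))
  refine ⟨_, Eq.mp (congrArg (QuadLip _) ?_) h⟩
  ext u v
  rw [curvBound, neg_mul, ← sub_eq_add_neg]

/-- On the outer piece this is `(|u| - |v|)² ≥ 0`; on the inner one `2u²/β ≤ 2βv² ≤ v²`. It makes
the radial derivative positive far out. -/
lemma sq_sub_sq_le_slope_mul (hβ : 0 < β) (hβ' : β ≤ 1 / 2) (u v : ℝ) :
    u ^ 2 - v ^ 2 ≤ slope β u v * u := by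
  rcases le_total (β * |v|) |u| with h | h
  · have e : slope β u v * u = 2 * |u| ^ 2 - 2 * |u| * |v| := by
      rcases le_total 0 u with hu | hu
      · rw [abs_of_nonneg hu] at h ⊢
        rw [slope_of_ge hβ h]; ring
      · rw [abs_of_nonpos hu] at h ⊢
        rw [slope_of_le_neg hβ (by linarith)]; ring
    rw [e, ← sq_abs u, ← sq_abs v]
    nlinarith [sq_nonneg (|u| - |v|)]
  · rw [slope_of_abs_le h]
    have h1 : 0 ≤ u ^ 3 / (β ^ 2 * v ^ 2) * u := by
      have : u ^ 3 / (β ^ 2 * v ^ 2) * u = (u ^ 2) ^ 2 / (β ^ 2 * v ^ 2) := by ring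
      rw [this]; positivity
    have h2 : u ^ 2 ≤ β ^ 2 * v ^ 2 := by
      have := pow_le_pow_left₀ (by positivity) h 2
      rwa [mul_pow, sq_abs, sq_abs] at this
    have h3 : 2 / β * u ^ 2 ≤ v ^ 2 := by
      calc 2 / β * u ^ 2 ≤ 2 / β * (β ^ 2 * v ^ 2) := by gcongr
        _ = 2 * β * v ^ 2 := by field_simp
        _ ≤ 1 * v ^ 2 := by gcongr; linarith
        _ = _ := one_mul _
    nlinarith

/-- A lower bound for `slope β u v * (u - v) / ρ²` if `u = v + ρ U` and `0 < ρ ≤ ε`. -/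
noncomputable def nearBound (β ε : ℝ) (U v : ℝ) : ℝ :=
  2 * U ^ 2 - (2 + 5 * slopeLip β) * min (U ^ 2) (max (2 * U ^ 2 - |U| * |v| / (2 * ε)) 0)

lemma quadLip_nearBound (β ε : ℝ) : ∃ L, QuadLip L (nearBound β ε) := by
  have h := (quadLip_sq_fst.const_mul 2).add ((quadLip_sq_fst.min (((quadLip_sq_fst.const_mul 2).add
    ((linLip_fst.abs.mul linLip_snd.abs).const_mul (-(1 / (2 * ε))))).max quadLip_zero)).const_mul
      (-(2 + 5 * slopeLip β)))
  refine ⟨_, Eq.mp (congrArg (QuadLip _) ?_) h⟩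
  ext u v
  rw [nearBound, neg_mul, ← sub_eq_add_neg, neg_mul, ← sub_eq_add_neg, one_div_mul_eq_div]

/-- If `|v| ≥ 2ρ|U|`, then `v + ρU` keeps the sign of `v` and at least half of its size, so it lies
on the outer piece as `β ≤ 1/2`, and the slope is `2ρU`. Otherwise `|v| ≤ 2ε|U|`, the cutoff equals
`U²`, and the bound becomes `-5 slopeLip β U²`, which the Lipschitz estimate ensures. -/
lemma nearBound_le (hβ : 0 < β) (hβ' : β ≤ 1 / 2) {ε ρ : ℝ} (hρ : 0 < ρ) (hρε : ρ ≤ ε) (U v : ℝ) :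
    ρ ^ 2 * nearBound β ε U v ≤ slope β (v + ρ * U) v * (ρ * U) := by
  have hL := (linLip_slope hβ).nonneg
  have hε : 0 < ε := hρ.trans_le hρε
  have hmin : 0 ≤ min (U ^ 2) (max (2 * U ^ 2 - |U| * |v| / (2 * ε)) 0) :=
    le_min (sq_nonneg U) (le_max_right _ _)
  have good : slope β (v + ρ * U) v = 2 * (ρ * U) →
      ρ ^ 2 * nearBound β ε U v ≤ slope β (v + ρ * U) v * (ρ * U) := by
    intro h
    rw [h, nearBound]
    have : 0 ≤ ρ ^ 2 * ((2 + 5 * slopeLip β) *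
      min (U ^ 2) (max (2 * U ^ 2 - |U| * |v| / (2 * ε)) 0)) := by positivity
    linarith
  have bad : |v| ≤ 2 * |ρ * U| →
      ρ ^ 2 * nearBound β ε U v ≤ slope β (v + ρ * U) v * (ρ * U) := by
    intro h
    have h1 : min (U ^ 2) (max (2 * U ^ 2 - |U| * |v| / (2 * ε)) 0) = U ^ 2 := by
      refine min_eq_left (le_max_of_le_left ?_)
      have : |U| * |v| / (2 * ε) ≤ U ^ 2 := by
        rw [div_le_iff₀ (by positivity), ← sq_abs U]
        rw [abs_mul, abs_of_pos hρ] at h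
        have : |v| ≤ 2 * (ε * |U|) := h.trans (by gcongr)
        nlinarith [abs_nonneg U]
      linarith
    rw [nearBound, h1]
    have h2 := (linLip_slope hβ).bound (v + ρ * U) v
    have h3 : |slope β (v + ρ * U) v| ≤ slopeLip β * (5 * |ρ * U|) := by
      refine h2.trans (mul_le_mul_of_nonneg_left ?_ hL)
      linarith [abs_add_le v (ρ * U)]
    have h4 : |slope β (v + ρ * U) v * (ρ * U)| ≤ slopeLip β * (5 * (ρ * U) ^ 2) := by
      rw [abs_mul, ← sq_abs (ρ * U)]
      calc _ ≤ slopeLip β * (5 * |ρ * U|) * |ρ * U| := by gcongr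
        _ = _ := by ring
    have h5 := (abs_le.1 h4).1
    nlinarith [sq_nonneg (ρ * U)]
  set h := ρ * U with hh
  rcases le_total |v| (2 * |h|) with hv | hv
  · exact bad hv
  · refine good ?_
    rcases le_total 0 v with h0 | h0
    · rw [abs_of_nonneg h0] at hv
      have := neg_abs_le h
      rw [slope_of_ge hβ (by rw [abs_of_nonneg h0]; nlinarith), abs_of_nonneg h0]; ring
    · rw [abs_of_nonpos h0] at hv
      have := le_abs_self h
      rw [slope_of_le_neg hβ (by rw [abs_of_nonpos h0]; nlinarith), abs_of_nonpos h0]; ring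

/-! ### Pointwise ingredients of the expected landscape -/

/-- `|slope β u v|` is strictly decreasing in `|v|`. -/
lemma mul_slope_lt_of_abs_lt (hβ : 0 < β) {u v v' : ℝ} (hu : u ≠ 0) (hv : |v| < |v'|) :
    u * slope β u v' < u * slope β u v := by
  wlog hu0 : 0 < u generalizing u
  · have := this (u := -u) (by simpa using hu) (by
      rcases lt_or_gt_of_ne hu with h | h
      · linarith
      · exact absurd h hu0)
    rw [slope_neg hβ, slope_neg hβ] at this
    linarith
  refine mul_lt_mul_of_pos_left ?_ hu0
  rw [← slope_abs_right u v, ← slope_abs_right u v']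
  have outer : ∀ p q : ℝ, 0 ≤ p → p < q → β * q ≤ u → slope β u q < slope β u p := by
    intro p q hp hpq h
    rw [slope_of_ge hβ (by rwa [abs_of_nonneg (hp.trans hpq.le)]),
      slope_of_ge hβ (by rw [abs_of_nonneg hp]; nlinarith), abs_of_nonneg hp,
      abs_of_nonneg (hp.trans hpq.le)]
    linarith
  have inner : ∀ p q : ℝ, 0 < p → p < q → u ≤ β * p → slope β u q < slope β u p := by
    intro p q hp hpq h
    rw [slope_of_abs_le (by rw [abs_of_pos hu0, abs_of_pos (hp.trans hpq)]; nlinarith),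
      slope_of_abs_le (by rwa [abs_of_pos hu0, abs_of_pos hp])]
    gcongr
  have hp := abs_nonneg v
  rcases le_total (β * |v'|) u with h | h
  · exact outer _ _ hp hv h
  have hq : 0 < u / β := by positivity
  have huq : β * (u / β) = u := by field_simp
  rcases le_total u (β * |v|) with h' | h'
  · exact inner _ _ (by nlinarith) hv h'
  have h1 : |v| ≤ u / β := by rw [le_div_iff₀ hβ]; linarith
  have h2 : u / β ≤ |v'| := by rw [div_le_iff₀ hβ]; linarith
  rcases h1.eq_or_lt with h1 | h1
  · exact inner _ _ (by rwa [h1]) hv (by rw [h1, huq])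
  rcases h2.eq_or_lt with h2 | h2
  · exact outer _ _ hp hv (by rw [← h2, huq])
  exact (inner _ _ hq h2 huq.ge).trans (outer _ _ hp h1 huq.le)

lemma slope_one_ne_zero (hβ : 0 < β) (hβ' : β ≤ 1 / 2) {p : ℝ} (h0 : p ≠ 0) (h1 : p ≠ 1)
    (h2 : p ≠ -1) : slope β p 1 ≠ 0 := by
  rcases le_total (β * |1|) p with h | h
  · rw [slope_of_ge hβ h, abs_one]
    intro hc; exact h1 (by linarith)
  rcases le_total p (-(β * |1|)) with h' | h'
  · rw [slope_of_le_neg hβ h', abs_one]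
    intro hc; exact h2 (by linarith)
  · rw [slope_of_abs_le (abs_le.2 ⟨h', h⟩)]
    have e : (1 - 2 / β) * p + p ^ 3 / (β ^ 2 * 1 ^ 2) = p * (1 - 2 / β + p ^ 2 / β ^ 2) := by ring
    rw [e]
    refine mul_ne_zero h0 (ne_of_lt ?_)
    rw [abs_one, mul_one] at h h'
    have : p ^ 2 / β ^ 2 ≤ 1 := by rw [div_le_one (by positivity)]; nlinarith
    have : 4 ≤ 2 / β := by rw [le_div_iff₀ hβ]; linarith
    linarith

/-- The second derivative of `t ↦ term β (u + t v) v` at `0`, if `|u| ≠ β|v|`. -/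
noncomputable def curv (β u v : ℝ) : ℝ :=
  if |u| < β * |v| then 3 / β ^ 2 * u ^ 2 + (1 - 2 / β) * v ^ 2 else 2 * v ^ 2

/-- `-u v ∂ᵥ slope β u v`, if `|u| ≠ β|v|`. -/
noncomputable def mixed (β u v : ℝ) : ℝ :=
  if |u| < β * |v| then 2 * u ^ 4 / (β ^ 2 * v ^ 2) else 2 * |u| * |v|

lemma mixed_pos (hβ : 0 < β) {u v : ℝ} (hu : u ≠ 0) (hv : v ≠ 0) : 0 < mixed β u v := by
  have := abs_pos.2 hu
  have := abs_pos.2 hv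
  unfold mixed
  split_ifs <;> positivity

lemma mixed_nonneg (u v : ℝ) : 0 ≤ mixed β u v := by
  unfold mixed
  split_ifs <;> positivity

lemma mixed_le (hβ : 0 < β) (u v : ℝ) : mixed β u v ≤ 2 * (u ^ 2 + v ^ 2) := by
  unfold mixed
  split_ifs with h
  · have hv : 0 < |v| := by
      by_contra hcon
      nlinarith [abs_nonneg u]
    have hv' : v ≠ 0 := abs_pos.1 hv
    have h2 : u ^ 2 ≤ β ^ 2 * v ^ 2 := by
      have := pow_le_pow_left₀ (abs_nonneg u) h.le 2
      rwa [mul_pow, sq_abs, sq_abs] at this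
    rw [div_le_iff₀ (by positivity)]
    nlinarith [mul_nonneg (sq_nonneg u) (sub_nonneg.2 h2), mul_nonneg (sq_nonneg v) (by positivity : 0 ≤ β ^ 2 * v ^ 2)]
  · rw [← sq_abs u, ← sq_abs v]
    nlinarith [sq_nonneg (|u| - |v|), sq_nonneg (|u|), sq_nonneg (|v|)]

lemma measurable_curv (β : ℝ) : Measurable (Function.uncurry (curv β)) := by
  unfold curv Function.uncurry
  exact Measurable.ite (measurableSet_lt (by fun_prop) (by fun_prop)) (by fun_prop) (by fun_prop)

lemma measurable_mixed (β : ℝ) : Measurable (Function.uncurry (mixed β)) := by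
  unfold mixed Function.uncurry
  exact Measurable.ite (measurableSet_lt (by fun_prop) (by fun_prop)) (by fun_prop) (by fun_prop)

lemma abs_curvBound_le (hβ : 0 < β) (hβ' : β ≤ 1 / 2) (k : ℕ) (u v : ℝ) :
    |curvBound β k u v| ≤ 2 / β * v ^ 2 := by
  have h4 : 4 ≤ 2 / β := by rw [le_div_iff₀ hβ]; linarith
  have h0 : 0 ≤ (k + 1) * (2 / β - 2) / β ^ 2 *
      max (u ^ 2 - (1 - 1 / (k + 1)) * β ^ 2 * v ^ 2) 0 := by
    have : 0 ≤ 2 / β - 2 := by linarith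
    exact mul_nonneg (by positivity) (le_max_right _ _)
  have h1 : 0 ≤ 3 / β ^ 2 * u ^ 2 := by positivity
  rw [abs_le]
  constructor
  · refine le_min ?_ ?_ <;> nlinarith [sq_nonneg v]
  · exact (min_le_left _ _).trans (by gcongr; linarith)

lemma tendsto_curvBound (hβ : 0 < β) (hβ' : β ≤ 1 / 2) {u v : ℝ} (h : |u| ≠ β * |v|) :
    Tendsto (fun k : ℕ => curvBound β k u v) atTop (𝓝 (curv β u v)) := by
  rcases lt_or_gt_of_ne h with h | h
  · have h2 : u ^ 2 < β ^ 2 * v ^ 2 := by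
      have := pow_lt_pow_left₀ h (abs_nonneg u) two_ne_zero
      rwa [mul_pow, sq_abs, sq_abs] at this
    have hlim : Tendsto (fun k : ℕ => (1 - 1 / ((k : ℝ) + 1)) * β ^ 2 * v ^ 2) atTop
        (𝓝 ((1 - 0) * β ^ 2 * v ^ 2)) :=
      ((tendsto_one_div_add_atTop_nhds_zero_nat.const_sub 1).mul_const _).mul_const _
    refine tendsto_const_nhds.congr' ?_
    filter_upwards [hlim.eventually_const_lt (u := u ^ 2) (by linarith)] with k hk
    rw [curv, if_pos h, curvBound, max_eq_right (by linarith), mul_zero, add_zero, min_eq_right]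
    have hb : 2 ≤ 1 / β := by rw [le_div_iff₀ hβ]; linarith
    have hb2 : 2 / β = 2 * (1 / β) := by ring
    have h3 : u ^ 2 / β ^ 2 ≤ v ^ 2 := by rw [div_le_iff₀ (by positivity)]; linarith
    have h6 : 3 / β ^ 2 * u ^ 2 = 3 * (u ^ 2 / β ^ 2) := by ring
    rw [h6, hb2]; nlinarith [sq_nonneg v]
  · rw [curv, if_neg h.not_gt]
    simp only [curvBound_of_ge hβ hβ' _ h.le]
    exact tendsto_const_nhds

/-- The derivative of `slope β u v * v` along the rotation of the pair `(u / ρ, v)`. -/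
lemma hasDerivAt_slope_rotation (hβ : 0 < β) {ρ u v : ℝ} (hρ : ρ ≠ 0) (hv : v ≠ 0)
    (h : |u| ≠ β * |v|) :
    HasDerivAt (fun θ : ℝ => slope β (Real.cos θ * u - ρ * Real.sin θ * v)
        (Real.cos θ * v + Real.sin θ * u / ρ) * (Real.cos θ * v + Real.sin θ * u / ρ))
      (-ρ * curv β u v + (slope β u v * u - mixed β u v) / ρ) 0 := by
  have hU : HasDerivAt (fun θ : ℝ => Real.cos θ * u - ρ * Real.sin θ * v) (-(ρ * v)) 0 := by
    have := ((Real.hasDerivAt_cos 0).mul_const u).fun_sub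
      (((Real.hasDerivAt_sin 0).const_mul ρ).mul_const v)
    simpa using this
  have hV : HasDerivAt (fun θ : ℝ => Real.cos θ * v + Real.sin θ * u / ρ) (u / ρ) 0 := by
    have := ((Real.hasDerivAt_cos 0).mul_const v).fun_add
      (((Real.hasDerivAt_sin 0).mul_const u).div_const ρ)
    simpa using this
  set U := fun θ : ℝ => Real.cos θ * u - ρ * Real.sin θ * v with hUdef
  set V := fun θ : ℝ => Real.cos θ * v + Real.sin θ * u / ρ with hVdef
  have hU0 : U 0 = u := by simp [hUdef]
  have hV0 : V 0 = v := by simp [hVdef]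
  change HasDerivAt (fun θ => slope β (U θ) (V θ) * V θ) _ 0
  have hUc : Tendsto U (𝓝 0) (𝓝 u) := by simpa [hU0] using hU.continuousAt.tendsto
  have hVc : Tendsto V (𝓝 0) (𝓝 v) := by simpa [hV0] using hV.continuousAt.tendsto
  have hd : Tendsto (fun θ => β * |V θ| - |U θ|) (𝓝 0) (𝓝 (β * |v| - |u|)) :=
    (hVc.abs.const_mul β).sub hUc.abs
  rcases lt_or_gt_of_ne h with h | h
  · have hq : HasDerivAt (fun θ => ((1 - 2 / β) * U θ + U θ ^ 3 / (β ^ 2 * V θ ^ 2)) * V θ) _ 0 :=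
      ((hU.const_mul (1 - 2 / β)).fun_add ((hU.fun_pow 3).fun_div ((hV.fun_pow 2).const_mul (β ^ 2))
        (by simp only [hV0]; positivity))).fun_mul hV
    refine (hq.congr_of_eventuallyEq ?_).congr_deriv ?_
    · filter_upwards [hd.eventually_const_lt (u := 0) (by linarith)] with θ hθ
      rw [slope_of_abs_le (by linarith)]
    · rw [curv, mixed, if_pos h, if_pos h, slope_of_abs_le h.le]
      simp [hU0, hV0]
      field_simp
      ring
  · have key : ∀ c d : ℝ, (c = 1 ∨ c = -1) → (d = 1 ∨ d = -1) → |u| = c * u → |v| = d * v →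
        HasDerivAt (fun θ => slope β (U θ) (V θ) * V θ)
          (-ρ * curv β u v + (slope β u v * u - mixed β u v) / ρ) 0 := by
      intro c d hc hd' hcu hdv
      have hform : ∀ p q : ℝ, β * |q| ≤ c * p → 0 < d * q → slope β p q * q =
          2 * p * q - 2 * c * d * q ^ 2 := by
        intro p q hp hq
        have hq' : |q| = d * q := by
          rcases hd' with rfl | rfl
          · rw [abs_of_pos (by linarith)]; ring
          · rw [abs_of_neg (by linarith)]; ring
        rcases hc with rfl | rfl
        · rw [slope_of_ge hβ (by linarith), hq']; ring
        · rw [slope_of_le_neg hβ (by linarith), hq']; ring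
      have hdv0 : 0 < d * v := by rw [← hdv]; exact abs_pos.2 hv
      have hq : HasDerivAt (fun θ => 2 * U θ * V θ - 2 * c * d * V θ ^ 2) _ 0 :=
        ((hU.const_mul 2).fun_mul hV).fun_sub ((hV.fun_pow 2).const_mul (2 * c * d))
      refine (hq.congr_of_eventuallyEq ?_).congr_deriv ?_
      · have e1 : Tendsto (fun θ => c * U θ - β * |V θ|) (𝓝 0) (𝓝 (c * u - β * |v|)) :=
          (hUc.const_mul c).sub (hVc.abs.const_mul β)
        filter_upwards [e1.eventually_const_lt (u := 0) (by linarith),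
          (hVc.const_mul d).eventually_const_lt hdv0] with θ h1 h2
        exact hform _ _ (by linarith) h2
      · have e2 := hform u v (by linarith) hdv0
        have e3 : slope β u v * u = 2 * u * u - 2 * c * d * v * u := by
          have : slope β u v = 2 * u - 2 * c * d * v := by
            refine mul_right_cancel₀ hv ?_
            rw [e2]; ring
          rw [this]; ring
        rw [curv, mixed, if_neg h.not_gt, if_neg h.not_gt, hcu, hdv, e3]
        simp [hU0, hV0]
        field_simp
        ring
    have sgn : ∀ y : ℝ, ∃ c : ℝ, (c = 1 ∨ c = -1) ∧ |y| = c * y := by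
      intro y
      rcases le_total 0 y with hy | hy
      · exact ⟨1, Or.inl rfl, by rw [abs_of_nonneg hy, one_mul]⟩
      · exact ⟨-1, Or.inr rfl, by rw [abs_of_nonpos hy]; ring⟩
    obtain ⟨c, hc, hcu⟩ := sgn u
    obtain ⟨d, hd', hdv⟩ := sgn v
    exact key c d hc hd' hcu hdv

lemma integral_pos_of_ae_pos {α : Type*} {m : MeasurableSpace α} {μ : Measure α}
    [IsProbabilityMeasure μ] {f : α → ℝ} (hf : Integrable f μ) (h : ∀ᵐ a ∂μ, 0 < f a) :
    0 < ∫ a, f a ∂μ := by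
  have h0 : 0 ≤ᵐ[μ] f := h.mono fun _ ha => ha.le
  refine (integral_nonneg_of_ae h0).lt_of_ne fun hcon => ?_
  have := (integral_eq_zero_iff_of_nonneg_ae h0 hf).1 hcon.symm
  obtain ⟨a, h1, h2⟩ := (h.and this).exists
  exact h1.ne' h2

/-! ### The landscape of the expected loss -/

section Plane

variable {E : Type*} [NormedAddCommGroup E] [InnerProductSpace ℝ E] [FiniteDimensional ℝ E]
  [MeasurableSpace E] [BorelSpace E]

lemma quadLip_slope_mul_fst (hβ : 0 < β) :
    QuadLip (2 * (slopeLip β * 1)) fun u v => slope β u v * u :=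
  (linLip_slope hβ).mul linLip_fst

lemma quadLip_slope_mul_snd (hβ : 0 < β) :
    QuadLip (2 * (slopeLip β * 1)) fun u v => slope β u v * v :=
  (linLip_slope hβ).mul linLip_snd

/-- At vectors that are neither parallel nor orthogonal to `x`, the population loss has a nonzero
derivative along the sphere. -/
lemma pop_slope_ne_zero_of_oblique (hβ : 0 < β) {z x : E} (hp : inner ℝ z x ≠ 0)
    (hd : inner ℝ z x • z - ‖z‖ ^ 2 • x ≠ 0) :
    pop (fun u v => slope β u v * u) z x ≠ 0 ∨ pop (fun u v => slope β u v * v) z x ≠ 0 := by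
  set p := inner ℝ z x with hpdef
  have hz : z ≠ 0 := fun h => hp (by rw [hpdef, h, inner_zero_left])
  have hz0 : 0 < ‖z‖ := norm_pos_iff.2 hz
  -- The reflection of `x` in the line of `z`: it preserves the Gram matrix and negates the pairing
  -- of `g` with `p z - ‖z‖² x`, the direction orthogonal to `z`.
  set y : E := (2 * p / ‖z‖ ^ 2) • z - x with hy
  have hzy : inner ℝ z y = p := by
    rw [hy, inner_sub_right, inner_smul_right, real_inner_self_eq_norm_sq, ← hpdef]
    field_simp; ring
  have hyn : ‖x‖ = ‖y‖ := by
    have : ‖y‖ ^ 2 = ‖x‖ ^ 2 := by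
      rw [hy, norm_sub_sq_real, inner_smul_left, norm_smul, ← hpdef, mul_pow, Real.norm_eq_abs,
        sq_abs]
      simp
      field_simp; ring
    exact ((sq_eq_sq₀ (norm_nonneg _) (norm_nonneg _)).1 this).symm
  have hg : SameGram z x z y := ⟨rfl, hyn, hzy.symm⟩
  obtain ⟨L, hq⟩ : ∃ L, QuadLip L fun u v =>
      slope β u v * (p * u) + -(slope β u v * (‖z‖ ^ 2 * v)) := by
    have h := ((quadLip_slope_mul_fst hβ).const_mul p).add
      ((quadLip_slope_mul_snd hβ).const_mul (-‖z‖ ^ 2))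
    refine ⟨_, Eq.mp (congrArg (QuadLip _) ?_) h⟩
    ext u v
    ring
  have hsym := hg.integral_eq hq.meas
  have hi := hq.integrable z x
  have hi' := hq.integrable z y
  have hval : ∫ g, (slope β (inner ℝ g z) (inner ℝ g x) * (p * inner ℝ g z) +
      -(slope β (inner ℝ g z) (inner ℝ g x) * (‖z‖ ^ 2 * inner ℝ g x))) ∂stdGaussian E =
      p * pop (fun u v => slope β u v * u) z x - ‖z‖ ^ 2 * pop (fun u v => slope β u v * v) z x := by
    rw [pop, pop, ← integral_const_mul, ← integral_const_mul, ← integral_sub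
      (((quadLip_slope_mul_fst hβ).integrable z x).const_mul _)
      (((quadLip_slope_mul_snd hβ).integrable z x).const_mul _)]
    refine integral_congr_ae (ae_of_all _ fun g => ?_)
    ring
  have hpos := integral_pos_of_ae_pos ((hi.add hi').const_mul p) (by
    filter_upwards [ae_inner_ne_zero hz, ae_inner_ne_zero hd] with g hu hw
    set u := inner ℝ g z
    set v := inner ℝ g x
    have hv' : inner ℝ g y = 2 * p / ‖z‖ ^ 2 * u - v := by
      rw [hy, inner_sub_right, inner_smul_right]
    have hw' : inner ℝ g (p • z - ‖z‖ ^ 2 • x) = p * u - ‖z‖ ^ 2 * v := by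
      rw [inner_sub_right, inner_smul_right, inner_smul_right]
    rw [hw'] at hw
    set w := p * u - ‖z‖ ^ 2 * v with hwdef
    set v' := inner ℝ g y
    have e0 : p * u - ‖z‖ ^ 2 * v' = -w := by
      rw [hv', hwdef]; field_simp; ring
    -- So `p u w` has the sign of `|v'| - |v|`, hence by monotonicity of the slope in `|v|` that of
    -- `u slope β u v - u slope β u v'`; the symmetrized integrand is a positive multiple of their
    -- product.
    have e1 : v' ^ 2 - v ^ 2 = 4 / ‖z‖ ^ 4 * (p * u * w) := by
      rw [hv', hwdef]; field_simp; ring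
    have e2 : p * ((fun g => slope β (inner ℝ g z) (inner ℝ g x) * (p * inner ℝ g z) +
      -(slope β (inner ℝ g z) (inner ℝ g x) * (‖z‖ ^ 2 * inner ℝ g x))) g +
      (fun g => slope β (inner ℝ g z) (inner ℝ g y) * (p * inner ℝ g z) +
      -(slope β (inner ℝ g z) (inner ℝ g y) * (‖z‖ ^ 2 * inner ℝ g y))) g) =
      (u * slope β u v - u * slope β u v') * (p * u * w) / u ^ 2 := by
      change p * ((slope β u v * (p * u) + -(slope β u v * (‖z‖ ^ 2 * v))) +
        (slope β u v' * (p * u) + -(slope β u v' * (‖z‖ ^ 2 * v')))) = _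
      have : (slope β u v * (p * u) + -(slope β u v * (‖z‖ ^ 2 * v))) +
        (slope β u v' * (p * u) + -(slope β u v' * (‖z‖ ^ 2 * v'))) =
        slope β u v * w + slope β u v' * (p * u - ‖z‖ ^ 2 * v') := by rw [hwdef]; ring
      rw [this, e0]
      field_simp
      ring
    refine lt_of_lt_of_eq ?_ e2.symm
    have hne : p * u * w ≠ 0 := mul_ne_zero (mul_ne_zero hp hu) hw
    have h4 : 0 < 4 / ‖z‖ ^ 4 := by positivity
    refine div_pos ?_ (by positivity)
    rcases lt_or_gt_of_ne hne with h | h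
    · refine mul_pos_of_neg_of_neg (sub_neg.2 (mul_slope_lt_of_abs_lt hβ hu ?_)) h
      rw [← sq_lt_sq]
      nlinarith [mul_neg_of_pos_of_neg h4 h]
    · refine mul_pos (sub_pos.2 (mul_slope_lt_of_abs_lt hβ hu ?_)) h
      rw [← sq_lt_sq]
      nlinarith [mul_pos h4 h])
  rw [integral_const_mul] at hpos
  by_contra! hcon
  rw [hcon.1, hcon.2, mul_zero, mul_zero, sub_zero] at hval
  have : ∫ g, ((fun g => slope β (inner ℝ g z) (inner ℝ g x) * (p * inner ℝ g z) +
      -(slope β (inner ℝ g z) (inner ℝ g x) * (‖z‖ ^ 2 * inner ℝ g x))) g +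
      (fun g => slope β (inner ℝ g z) (inner ℝ g y) * (p * inner ℝ g z) +
      -(slope β (inner ℝ g z) (inner ℝ g y) * (‖z‖ ^ 2 * inner ℝ g y))) g) ∂stdGaussian E = 0 := by
    rw [integral_add hi hi', ← hsym, hval, add_zero]
  have h0 : p * 0 = p * _ := congrArg (p * ·) this.symm
  rw [mul_zero] at h0
  exact hpos.ne h0

/-- The kinks lie on the hyperplanes orthogonal to `z ± βx`, and these vectors are nonzero because
`z` is orthogonal to `x`. -/
lemma ae_abs_inner_ne (hβ : 0 < β) {z x : E} (hx : x ≠ 0) (h : inner ℝ z x = 0) :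
    ∀ᵐ g ∂stdGaussian E, |inner ℝ g z| ≠ β * |inner ℝ g x| := by
  have h1 : z - β • x ≠ 0 := by
    intro h0
    have := congrArg (fun w => inner ℝ w x) h0
    simp only [inner_sub_left, inner_smul_left, h, inner_zero_left, zero_sub,
      real_inner_self_eq_norm_sq] at this
    have := norm_pos_iff.2 hx
    simp_all
  have h2 : z + β • x ≠ 0 := by
    intro h0
    have := congrArg (fun w => inner ℝ w x) h0
    simp only [inner_add_left, inner_smul_left, h, inner_zero_left, zero_add,
      real_inner_self_eq_norm_sq] at this
    have := norm_pos_iff.2 hx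
    simp_all
  filter_upwards [ae_inner_ne_zero h1, ae_inner_ne_zero h2] with g hg1 hg2 hcon
  rw [inner_sub_right, inner_smul_right] at hg1
  rw [inner_add_right, inner_smul_right] at hg2
  rw [← abs_of_pos hβ, ← abs_mul, abs_eq_abs] at hcon
  rcases hcon with hcon | hcon
  · exact hg1 (by linarith)
  · exact hg2 (by linarith)

lemma abs_curv_le (hβ : 0 < β) (hβ' : β ≤ 1 / 2) {u v : ℝ} (h : |u| ≠ β * |v|) :
    |curv β u v| ≤ 2 / β * v ^ 2 :=
  le_of_tendsto (tendsto_curvBound hβ hβ' h).abs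
    (Eventually.of_forall fun k => abs_curvBound_le hβ hβ' k u v)

/-- At vectors orthogonal to `x`, the population loss has a nonzero radial derivative, or a negative
second derivative along `x`. -/
lemma integral_curv_neg_of_orthogonal (hβ : 0 < β) (hβ' : β ≤ 1 / 2) {z x : E} (hx : ‖x‖ = 1)
    (hz : z ≠ 0) (h : inner ℝ z x = 0) (h0 : pop (fun u v => slope β u v * u) z x = 0) :
    ∫ g, curv β (inner ℝ g z) (inner ℝ g x) ∂stdGaussian E < 0 := by
  set ρ := ‖z‖ with hρdef
  have hρ : 0 < ρ := norm_pos_iff.2 hz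
  have hx0 : x ≠ 0 := by rintro rfl; simp at hx
  -- The orthonormal pair `(z/ρ, x)` is rotated by `θ`, so the expectation of `slope * v` does not
  -- depend on `θ`.
  set Z : ℝ → E := fun θ => Real.cos θ • z - (ρ * Real.sin θ) • x with hZ
  set X : ℝ → E := fun θ => Real.cos θ • x + (Real.sin θ / ρ) • z with hX
  have h' : inner ℝ x z = 0 := by rw [real_inner_comm, h]
  have hgram : ∀ θ, SameGram (Z θ) (X θ) z x := by
    intro θ
    have hcs := Real.sin_sq_add_cos_sq θ
    refine ⟨?_, ?_, ?_⟩
    · refine (sq_eq_sq₀ (norm_nonneg _) (norm_nonneg _)).1 ?_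
      rw [hZ, norm_sub_sq_real]
      simp only [norm_smul, inner_smul_left, inner_smul_right, h, hx, mul_pow, Real.norm_eq_abs,
        sq_abs, ← hρdef]
      linear_combination ρ ^ 2 * hcs
    · refine (sq_eq_sq₀ (norm_nonneg _) (norm_nonneg _)).1 ?_
      rw [hX, norm_add_sq_real]
      simp only [norm_smul, inner_smul_left, inner_smul_right, h', hx, mul_pow, Real.norm_eq_abs,
        sq_abs, ← hρdef]
      field_simp
      linear_combination ρ * hcs
    · simp only [hZ, hX, inner_sub_left, inner_add_right, inner_smul_left, inner_smul_right, h, h',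
        real_inner_self_eq_norm_sq, hx, ← hρdef]
      simp
      field_simp
      ring
  have hiZ : ∀ θ (g : E), inner ℝ g (Z θ) =
      Real.cos θ * inner ℝ g z - ρ * Real.sin θ * inner ℝ g x := by
    intro θ g
    rw [hZ, inner_sub_right, inner_smul_right, inner_smul_right]
  have hiX : ∀ θ (g : E), inner ℝ g (X θ) =
      Real.cos θ * inner ℝ g x + Real.sin θ * inner ℝ g z / ρ := by
    intro θ g
    rw [hX, inner_add_right, inner_smul_right, inner_smul_right]; ring
  set F : ℝ → E → ℝ := fun θ g => slope β (inner ℝ g (Z θ)) (inner ℝ g (X θ)) * inner ℝ g (X θ)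
    with hF
  set F' : E → ℝ := fun g => -ρ * curv β (inner ℝ g z) (inner ℝ g x) +
    (slope β (inner ℝ g z) (inner ℝ g x) * inner ℝ g z - mixed β (inner ℝ g z) (inner ℝ g x)) / ρ
    with hF'
  have hconst : ∀ θ, ∫ g, F θ g ∂stdGaussian E =
      ∫ g, slope β (inner ℝ g z) (inner ℝ g x) * inner ℝ g x ∂stdGaussian E := fun θ =>
    (hgram θ).integral_eq (quadLip_slope_mul_snd hβ).meas
  have hmix_int : Integrable (fun g => mixed β (inner ℝ g z) (inner ℝ g x)) (stdGaussian E) := by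
    refine (((integrable_sq_inner z).add (integrable_sq_inner x)).const_mul 2).mono'
      ((measurable_mixed β).comp (measurable_inner_pair z x)).aestronglyMeasurable
      (ae_of_all _ fun g => ?_)
    rw [Real.norm_eq_abs, abs_of_nonneg (mixed_nonneg _ _)]
    exact mixed_le hβ _ _
  have hcurv_int : Integrable (fun g => curv β (inner ℝ g z) (inner ℝ g x)) (stdGaussian E) := by
    refine ((integrable_sq_inner x).const_mul (2 / β)).mono'
      ((measurable_curv β).comp (measurable_inner_pair z x)).aestronglyMeasurable ?_
    filter_upwards [ae_abs_inner_ne hβ hx0 h] with g hg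
    exact abs_curv_le hβ hβ' hg
  have hT_int := (quadLip_slope_mul_fst hβ).integrable z x
  have hTm_int : Integrable (fun g => (slope β (inner ℝ g z) (inner ℝ g x) * inner ℝ g z -
      mixed β (inner ℝ g z) (inner ℝ g x)) / ρ) (stdGaussian E) :=
    (hT_int.sub hmix_int).div_const ρ
  have hF'_int : Integrable F' (stdGaussian E) := (hcurv_int.const_mul (-ρ)).add hTm_int
  -- An integrable Lipschitz constant in `θ` permits differentiation under the integral although the
  -- slope has kinks; differentiability is then needed only almost surely at `θ = 0`.
  obtain ⟨D, hD0, hD⟩ : ∃ D : ℝ, 0 ≤ D ∧ ∀ (g : E) (s t : ℝ), |F s g - F t g| ≤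
      D * ‖g‖ ^ 2 * |s - t| := by
    set S := slopeLip β
    have hS : 0 ≤ S := (linLip_slope hβ).nonneg
    set N := 2 * ρ + 2 + 1 / ρ + 1
    have hN : 0 ≤ N := by positivity
    refine ⟨2 * S * N ^ 2 , by positivity, fun g s t => ?_⟩
    have hgz : |inner ℝ g z| ≤ ‖g‖ * ρ := abs_real_inner_le_norm g z
    have hgx : |inner ℝ g x| ≤ ‖g‖ := by simpa [hx] using abs_real_inner_le_norm g x
    have hcos : |Real.cos s - Real.cos t| ≤ |s - t| := by
      simpa [Real.dist_eq] using Real.lipschitzWith_cos.dist_le_mul s t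
    have hsin : |Real.sin s - Real.sin t| ≤ |s - t| := by
      simpa [Real.dist_eq] using Real.lipschitzWith_sin.dist_le_mul s t
    have dZ : |inner ℝ g (Z s) - inner ℝ g (Z t)| ≤ 2 * ρ * ‖g‖ * |s - t| := by
      have e : inner ℝ g (Z s) - inner ℝ g (Z t) = (Real.cos s - Real.cos t) * inner ℝ g z +
          -(ρ * ((Real.sin s - Real.sin t) * inner ℝ g x)) := by rw [hiZ, hiZ]; ring
      rw [e]
      refine (abs_add_le _ _).trans ?_
      rw [abs_neg, abs_mul, abs_mul, abs_mul, abs_of_pos hρ]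
      calc _ ≤ |s - t| * (‖g‖ * ρ) + ρ * (|s - t| * ‖g‖) := by gcongr
        _ = _ := by ring
    have dX : |inner ℝ g (X s) - inner ℝ g (X t)| ≤ 2 * ‖g‖ * |s - t| := by
      have e : inner ℝ g (X s) - inner ℝ g (X t) = (Real.cos s - Real.cos t) * inner ℝ g x +
          (Real.sin s - Real.sin t) * (inner ℝ g z / ρ) := by rw [hiX, hiX]; ring
      rw [e]
      refine (abs_add_le _ _).trans ?_
      rw [abs_mul, abs_mul, abs_div, abs_of_pos hρ]
      calc _ ≤ |s - t| * ‖g‖ + |s - t| * (‖g‖ * ρ / ρ) := by gcongr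
        _ = _ := by field_simp; ring
    have bZ : ∀ θ, |inner ℝ g (Z θ)| ≤ ‖g‖ * ρ := fun θ => by
      have := abs_real_inner_le_norm g (Z θ)
      rwa [(hgram θ).norm_left] at this
    have bX : ∀ θ, |inner ℝ g (X θ)| ≤ ‖g‖ := fun θ => by
      have := abs_real_inner_le_norm g (X θ)
      rwa [(hgram θ).norm_right, hx, mul_one] at this
    have e : F s g - F t g = slope β (inner ℝ g (Z s)) (inner ℝ g (X s)) *
        (inner ℝ g (X s) - inner ℝ g (X t)) + (slope β (inner ℝ g (Z s)) (inner ℝ g (X s)) -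
          slope β (inner ℝ g (Z t)) (inner ℝ g (X t))) * inner ℝ g (X t) := by
      simp only [hF]; ring
    rw [e]
    refine (abs_add_le _ _).trans ?_
    rw [abs_mul, abs_mul]
    calc _ ≤ S * (‖g‖ * ρ + ‖g‖) * (2 * ‖g‖ * |s - t|) +
          S * (2 * ρ * ‖g‖ * |s - t| + 2 * ‖g‖ * |s - t|) * ‖g‖ := by
          gcongr
          · exact ((linLip_slope hβ).bound _ _).trans (mul_le_mul_of_nonneg_left
              (add_le_add (bZ s) (bX s)) hS)
          · exact ((linLip_slope hβ).lip _ _ _ _).trans (mul_le_mul_of_nonneg_left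
              (add_le_add dZ dX) hS)
          · exact bX t
      _ = 2 * S * (2 * ρ + 2) * ‖g‖ ^ 2 * |s - t| := by ring
      _ ≤ 2 * S * N ^ 2 * ‖g‖ ^ 2 * |s - t| := by
          have h1 : 2 * ρ + 2 ≤ N := by
            have : 0 ≤ 1 / ρ := by positivity
            simp only [N]; linarith
          have h2 : N ≤ N ^ 2 := by
            have : 1 ≤ N := by linarith
            nlinarith
          gcongr
          exact h1.trans h2
  have hnorm : Integrable (fun g : E => ‖g‖ ^ 2) (stdGaussian E) :=
    (IsGaussian.memLp_id (stdGaussian E) 2 (by simp)).integrable_norm_pow two_ne_zero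
  obtain ⟨-, hder⟩ := hasDerivAt_integral_of_dominated_loc_of_lip (μ := stdGaussian E) (F := F)
    (F' := F') (x₀ := 0) (s := Set.univ) (bound := fun g => D * ‖g‖ ^ 2) univ_mem
    (Eventually.of_forall fun θ =>
      ((quadLip_slope_mul_snd hβ).measurable_comp (Z θ) (X θ)).aestronglyMeasurable)
    ((quadLip_slope_mul_snd hβ).integrable (Z 0) (X 0)) hF'_int.aestronglyMeasurable
    (ae_of_all _ fun g => LipschitzOnWith.of_dist_le_mul fun s _ t _ => by
      rw [Real.dist_eq, Real.dist_eq, Real.coe_nnabs, abs_of_nonneg (show 0 ≤ D * ‖g‖ ^ 2 by positivity)]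
      exact hD g s t)
    (hnorm.const_mul D)
    (by
      filter_upwards [ae_abs_inner_ne hβ hx0 h, ae_inner_ne_zero hx0] with g hg1 hg2
      have := hasDerivAt_slope_rotation hβ hρ.ne' hg2 hg1
      simpa only [hF, hiZ, hiX] using this)
  have hzero : ∫ g, F' g ∂stdGaussian E = 0 := by
    refine hder.unique ?_
    rw [show (fun θ => ∫ g, F θ g ∂stdGaussian E) = fun _ =>
      ∫ g, slope β (inner ℝ g z) (inner ℝ g x) * inner ℝ g x ∂stdGaussian E from funext hconst]
    exact hasDerivAt_const _ _
  have hmix : 0 < ∫ g, mixed β (inner ℝ g z) (inner ℝ g x) ∂stdGaussian E := by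
    refine integral_pos_of_ae_pos hmix_int ?_
    filter_upwards [ae_inner_ne_zero hz, ae_inner_ne_zero hx0] with g h1 h2
    exact mixed_pos hβ h1 h2
  have hsplit : ∫ g, F' g ∂stdGaussian E =
      -ρ * ∫ g, curv β (inner ℝ g z) (inner ℝ g x) ∂stdGaussian E +
      (pop (fun u v => slope β u v * u) z x -
        ∫ g, mixed β (inner ℝ g z) (inner ℝ g x) ∂stdGaussian E) / ρ := by
    rw [hF', integral_add (hcurv_int.const_mul (-ρ)) hTm_int,
      integral_const_mul, integral_div, integral_sub hT_int hmix_int, pop]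
  -- What remains is `0 = -ρ ∫ curv - (∫ mixed) / ρ` with `∫ mixed > 0`.
  rw [hzero, h0, zero_sub, neg_div] at hsplit
  have h3 : 0 < (∫ g, mixed β (inner ℝ g z) (inner ℝ g x) ∂stdGaussian E) / ρ := by positivity
  by_contra hcon
  have := mul_nonneg hρ.le (not_lt.1 hcon)
  linarith

lemma exists_pop_curvBound_neg (hβ : 0 < β) (hβ' : β ≤ 1 / 2) {z x : E} (hx : x ≠ 0)
    (h : inner ℝ z x = 0) (hneg : ∫ g, curv β (inner ℝ g z) (inner ℝ g x) ∂stdGaussian E < 0) :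
    ∃ k, pop (curvBound β k) z x < 0 := by
  have hlim : Tendsto (fun k => pop (curvBound β k) z x) atTop
      (𝓝 (∫ g, curv β (inner ℝ g z) (inner ℝ g x) ∂stdGaussian E)) := by
    refine tendsto_integral_of_dominated_convergence (fun g => 2 / β * inner ℝ g x ^ 2)
      (fun k => ?_) ((integrable_sq_inner x).const_mul _)
      (fun k => ae_of_all _ fun g => abs_curvBound_le hβ hβ' k _ _) ?_
    · obtain ⟨L, hL⟩ := quadLip_curvBound β k
      exact (hL.measurable_comp z x).aestronglyMeasurable
    · filter_upwards [ae_abs_inner_ne hβ hx h] with g hg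
      exact tendsto_curvBound hβ hβ' hg
  exact (hlim.eventually_lt_const hneg).exists

/-- The landscape of the population loss. -/
theorem pop_alternative (hβ : 0 < β) (hβ' : β ≤ 1 / 2) {z x : E} (hx : ‖x‖ = 1)
    (h1 : z ≠ x) (h2 : z ≠ -x) :
    pop (fun u v => slope β u v * u) z x ≠ 0 ∨ pop (fun u v => slope β u v * v) z x ≠ 0 ∨
      ∃ k, pop (curvBound β k) z x < 0 := by
  have hx0 : x ≠ 0 := by rintro rfl; simp at hx
  by_cases hp : inner ℝ z x = 0
  · rcases eq_or_ne z 0 with rfl | hz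
    · refine Or.inr (Or.inr (exists_pop_curvBound_neg hβ hβ' hx0 hp ?_))
      have e : ∫ g, curv β (inner ℝ g (0 : E)) (inner ℝ g x) ∂stdGaussian E =
          ∫ g, (1 - 2 / β) * inner ℝ g x ^ 2 ∂stdGaussian E := by
        refine integral_congr_ae ?_
        filter_upwards [ae_inner_ne_zero hx0] with g hg
        have := abs_pos.2 hg
        rw [inner_zero_right, curv, if_pos (by rw [abs_zero]; positivity)]
        simp
      rw [e, integral_const_mul, integral_sq_inner, hx]
      have : 4 ≤ 2 / β := by rw [le_div_iff₀ hβ]; linarith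
      linarith
    · by_cases h0 : pop (fun u v => slope β u v * u) z x = 0
      · exact Or.inr (Or.inr (exists_pop_curvBound_neg hβ hβ' hx0 hp
          (integral_curv_neg_of_orthogonal hβ hβ' hx hz hp h0)))
      · exact Or.inl h0
  by_cases hd : inner ℝ z x • z - ‖z‖ ^ 2 • x = 0
  -- Vanishing of this vector with `p ≠ 0` means that `z` is a multiple of `x`.
  · set p := inner ℝ z x with hpdef
    obtain ⟨c, rfl⟩ : ∃ c : ℝ, z = c • x :=
      ⟨p⁻¹ * ‖z‖ ^ 2, by rw [mul_smul, ← sub_eq_zero.1 hd, inv_smul_smul₀ hp]⟩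
    have hc : p = c := by
      rw [hpdef, inner_smul_left, real_inner_self_eq_norm_sq, hx]; simp
    rw [hc] at hp
    refine Or.inl ?_
    have e : pop (fun u v => slope β u v * u) (c • x) x = c * slope β c 1 := by
      rw [pop]
      simp only [inner_smul_right]
      rw [show (fun g : E => slope β (c * inner ℝ g x) (inner ℝ g x) * (c * inner ℝ g x)) =
        fun g : E => c * slope β c 1 * inner ℝ g x ^ 2 from funext fun g => by
          rw [slope_mul_self hβ]; ring, integral_const_mul, integral_sq_inner, hx]
      simp
    rw [e]
    refine mul_ne_zero hp (slope_one_ne_zero hβ hβ' hp ?_ ?_)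
    · rintro rfl; exact h1 (one_smul _ _)
    · rintro rfl; exact h2 (by simp)
  · rcases pop_slope_ne_zero_of_oblique hβ hp hd with h | h
    exacts [Or.inl h, Or.inr (Or.inl h)]

/-- As `ε → 0` the cutoff vanishes wherever `v ≠ 0`, so by dominated convergence the expectation
tends to `2‖z‖²`. -/
lemma exists_pop_nearBound_pos (hβ : 0 < β) {z x : E} (hx : x ≠ 0) (hz : z ≠ 0) :
    ∃ ε > 0, 0 < pop (nearBound β ε) z x := by
  have hS := (linLip_slope hβ).nonneg
  have hlim : Tendsto (fun k : ℕ => pop (nearBound β (1 / (k + 1))) z x) atTop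
      (𝓝 (∫ g, 2 * inner ℝ g z ^ 2 ∂stdGaussian E)) := by
    refine tendsto_integral_of_dominated_convergence
      (fun g => (4 + 5 * slopeLip β) * inner ℝ g z ^ 2)
      (fun k => ?_) ((integrable_sq_inner z).const_mul _) (fun k => ae_of_all _ fun g => ?_) ?_
    · obtain ⟨L, hL⟩ := quadLip_nearBound β (1 / (k + 1))
      exact (hL.measurable_comp z x).aestronglyMeasurable
    · generalize inner ℝ g z = U
      generalize inner ℝ g x = v
      rw [nearBound, Real.norm_eq_abs]
      set w := min (U ^ 2) (max (2 * U ^ 2 - |U| * |v| / (2 * (1 / ((k : ℝ) + 1)))) 0) with hw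
      have h1 : w ≤ U ^ 2 := min_le_left _ _
      have h2 : 0 ≤ w := le_min (sq_nonneg U) (le_max_right _ _)
      rw [abs_le]
      constructor <;> nlinarith [mul_le_mul_of_nonneg_left h1 hS, mul_nonneg hS h2]
    · filter_upwards [ae_inner_ne_zero hx] with g hg
      generalize inner ℝ g z = U
      generalize inner ℝ g x = v at hg
      rcases eq_or_ne U 0 with rfl | hU
      · simp [nearBound]
      refine tendsto_const_nhds.congr' ?_
      have h1 : Tendsto (fun k : ℕ => |v| / 2 * ((k : ℝ) + 1)) atTop atTop :=
        Tendsto.const_mul_atTop (by positivity) (tendsto_natCast_atTop_atTop.atTop_add tendsto_const_nhds)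
      filter_upwards [h1.eventually_ge_atTop (2 * |U|)] with k hk
      have : 2 * U ^ 2 - |U| * |v| / (2 * (1 / ((k : ℝ) + 1))) ≤ 0 := by
        have e : |U| * |v| / (2 * (1 / ((k : ℝ) + 1))) = |U| * (|v| / 2 * (k + 1)) := by
          field_simp
        rw [e, ← sq_abs]
        nlinarith [abs_nonneg U]
      rw [nearBound, max_eq_right this, min_eq_right (sq_nonneg U)]
      ring
  have hpos : 0 < ∫ g, 2 * inner ℝ g z ^ 2 ∂stdGaussian E := by
    rw [integral_const_mul, integral_sq_inner]
    have := norm_pos_iff.2 hz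
    positivity
  obtain ⟨k, hk⟩ := (hlim.eventually_const_lt hpos).exists
  exact ⟨1 / (k + 1), by positivity, hk⟩

lemma pop_abs_mul_abs_pos {z x : E} (hz : z ≠ 0) (hx : x ≠ 0) :
    0 < pop (fun u v => |u| * |v|) z x := by
  refine integral_pos_of_ae_pos ((linLip_fst.abs.mul linLip_snd.abs).integrable z x) ?_
  filter_upwards [ae_inner_ne_zero hz, ae_inner_ne_zero hx] with g h1 h2
  positivity

end Plane

/-! ### Compactness and the regions of the landscape -/

lemma curvBound_smul (k : ℕ) (t u v : ℝ) :
    curvBound β k (t * u) (t * v) = t ^ 2 * curvBound β k u v := by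
  have ht : 0 ≤ t ^ 2 := sq_nonneg t
  rw [curvBound, curvBound, mul_min_of_nonneg _ _ ht, mul_add, mul_left_comm (t ^ 2)
    (((k : ℝ) + 1) * (2 / β - 2) / β ^ 2), mul_max_of_nonneg _ _ ht, mul_zero]
  congr 1
  · ring
  · congr 1
    · ring
    · congr 2
      ring

/-- A rare event at each point of a compact set of Gram data is rare on the whole set. -/
lemma rare_of_isCompact {K : Set (EuclideanSpace ℝ (Fin 2))} (hK : IsCompact K)
    {Q : (n m : ℕ) → EuclideanSpace ℝ (Fin n) → (Fin m → EuclideanSpace ℝ (Fin n)) →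
      EuclideanSpace ℝ (Fin n) → Prop}
    (h : ∀ ζ₀ ∈ K, ∃ U ∈ 𝓝 ζ₀, Rare fun n m x a => ∃ z, ∃ ζ ∈ U, SameGram z x ζ e₀ ∧ Q n m x a z) :
    Rare fun n m x a => ∃ z, ∃ ζ ∈ K, SameGram z x ζ e₀ ∧ Q n m x a z := by
  refine hK.induction_on (p := fun S => Rare fun n m x a =>
    ∃ z, ∃ ζ ∈ S, SameGram z x ζ e₀ ∧ Q n m x a z) ?_ ?_ ?_ ?_
  · exact rare_false.mono fun n m x a _ _ ⟨z, ζ, hζ, _⟩ => hζ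
  · exact fun S T hST hT => hT.mono fun n m x a _ _ ⟨z, ζ, hζ, h⟩ => ⟨z, ζ, hST hζ, h⟩
  · refine fun S T hS hT => (hS.or hT).mono fun n m x a _ _ ⟨z, ζ, hζ, h⟩ => ?_
    exact hζ.imp (fun hζ => ⟨z, ζ, hζ, h⟩) (fun hζ => ⟨z, ζ, hζ, h⟩)
  · intro ζ₀ hζ₀
    obtain ⟨U, hU, hR⟩ := h ζ₀ hζ₀
    exact ⟨U, mem_nhdsWithin_of_mem_nhds hU, hR⟩

lemma ne_zero_of_norm_eq_one {E : Type*} [NormedAddCommGroup E] {z : E} (hz : ‖z‖ = 1) : z ≠ 0 := by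
  rintro rfl; simp at hz

/-- No nonzero vector `z` has all products `⟪aᵢ, z⟫ ⟪aᵢ, x⟫` equal to zero. -/
lemma rare_forall_inner_eq_zero : Rare fun _ _ x a => ∃ z, z ≠ 0 ∧
    ∀ i, inner ℝ (a i) z = 0 ∨ inner ℝ (a i) x = 0 := by
  refine (rare_of_isCompact (isCompact_sphere (0 : EuclideanSpace ℝ (Fin 2)) 1)
    (Q := fun n m x a z => ∑ i, |inner ℝ (a i) z| * |inner ℝ (a i) x| ≤ 0) fun ζ₀ hζ₀ =>
      exists_nhds_rare_sum_nonpos (linLip_fst.abs.mul linLip_snd.abs)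
        (pop_abs_mul_abs_pos (ne_zero_of_norm_eq_one (by simpa using hζ₀))
          (ne_zero_of_norm_eq_one norm_e₀))).mono ?_
  rintro n m x a - hx ⟨z, hz, hzero⟩
  have hz' := norm_pos_iff.2 hz
  obtain ⟨ζ, hζ⟩ := exists_sameGram (‖z‖⁻¹ • z) x hx
  refine ⟨‖z‖⁻¹ • z, ζ, ?_, hζ, ?_⟩
  · rw [mem_sphere_zero_iff_norm, ← hζ.norm_left, norm_smul, norm_inv, norm_norm,
      inv_mul_cancel₀ hz'.ne']
  · refine (Finset.sum_eq_zero fun i _ => ?_).le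
    rw [inner_smul_right]
    rcases hzero i with h | h <;> simp [h]

/-- The radial derivative of the loss is positive at vectors of large norm. -/
lemma rare_radial_nonpos (hβ : 0 < β) (hβ' : β ≤ 1 / 2) : Rare fun _ _ x a => ∃ z, 2 ≤ ‖z‖ ∧
    ∑ i, slope β (inner ℝ (a i) z) (inner ℝ (a i) x) * inner ℝ (a i) z ≤ 0 := by
  have hq := quadLip_sq_fst.add (quadLip_sq_snd.const_mul (-(1 / 4)))
  refine (rare_sum_le_pop hq (R := 1) zero_le_one (show (0 : ℝ) < 1 / 2 by norm_num)).mono ?_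
  rintro n m x a - hx ⟨z, hz, hle⟩
  have hz' : 0 < ‖z‖ := by linarith
  -- The region is unbounded, so `z` is normalized: after division by `‖z‖² ≥ 4` the bound `u² - v²`
  -- is at least `⟪aᵢ, y⟫² - v²/4`, of expectation `3/4`.
  set y := ‖z‖⁻¹ • z with hy
  have hyn : ‖y‖ = 1 := by rw [hy, norm_smul, norm_inv, norm_norm, inv_mul_cancel₀ hz'.ne']
  have hzy : z = ‖z‖ • y := by rw [hy, smul_inv_smul₀ hz'.ne']
  refine ⟨y, hyn.le, ?_⟩
  have hpop : pop (fun u v : ℝ => u ^ 2 + -(1 / 4) * v ^ 2) y x = 3 / 4 := by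
    rw [pop, integral_add (integrable_sq_inner y) ((integrable_sq_inner x).const_mul _),
      integral_const_mul, integral_sq_inner, integral_sq_inner, hx, hyn]
    norm_num
  rw [hpop]
  have hsum : ‖z‖ ^ 2 * ∑ i, (inner ℝ (a i) y ^ 2 + -(1 / 4) * inner ℝ (a i) x ^ 2) ≤ 0 := by
    refine le_trans ?_ hle
    rw [Finset.mul_sum]
    refine Finset.sum_le_sum fun i _ => (sq_sub_sq_le_slope_mul hβ hβ' _ _).trans' ?_
    have e : inner ℝ (a i) z = ‖z‖ * inner ℝ (a i) y := by
      conv_lhs => rw [hzy]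
      rw [inner_smul_right]
    rw [e]
    have h4 : 4 ≤ ‖z‖ ^ 2 := by nlinarith
    nlinarith [mul_nonneg (sub_nonneg.2 h4) (sq_nonneg (inner ℝ (a i) x))]
  have : ∑ i, (inner ℝ (a i) y ^ 2 + -(1 / 4) * inner ℝ (a i) x ^ 2) ≤ 0 := by
    by_contra! hcon
    exact hsum.not_gt (by positivity)
  refine this.trans ?_
  norm_num

/-- Near `x`, the derivative of the loss in the direction away from `x` is positive. -/
lemma exists_rare_near (hβ : 0 < β) (hβ' : β ≤ 1 / 2) : ∃ ε > 0, Rare fun _ _ x a => ∃ z,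
    z ≠ x ∧ ‖z - x‖ ≤ ε ∧ ∑ i, slope β (inner ℝ (a i) z) (inner ℝ (a i) x) *
      (inner ℝ (a i) z - inner ℝ (a i) x) ≤ 0 := by
  -- The admissible `ε` depends on the direction `y`, so it is carried through the compactness
  -- induction and shrunk at each union.
  have key : ∃ ε > 0, Rare fun _ _ x a => ∃ y, ∃ ζ ∈ Metric.sphere (0 : EuclideanSpace ℝ (Fin 2)) 1,
      SameGram y x ζ e₀ ∧ ∃ ρ, 0 < ρ ∧ ρ ≤ ε ∧
        ∑ i, slope β (inner ℝ (a i) x + ρ * inner ℝ (a i) y) (inner ℝ (a i) x) *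
          (ρ * inner ℝ (a i) y) ≤ 0 := by
    refine (isCompact_sphere (0 : EuclideanSpace ℝ (Fin 2)) 1).induction_on
      (p := fun S => ∃ ε > 0, Rare fun _ _ x a => ∃ y, ∃ ζ ∈ S, SameGram y x ζ e₀ ∧
        ∃ ρ, 0 < ρ ∧ ρ ≤ ε ∧
        ∑ i, slope β (inner ℝ (a i) x + ρ * inner ℝ (a i) y) (inner ℝ (a i) x) *
          (ρ * inner ℝ (a i) y) ≤ 0) ?_ ?_ ?_ ?_
    · exact ⟨1, one_pos, rare_false.mono fun n m x a _ _ ⟨z, ζ, hζ, _⟩ => hζ⟩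
    · rintro S T hST ⟨ε, hε, hT⟩
      exact ⟨ε, hε, hT.mono fun n m x a _ _ ⟨z, ζ, hζ, h⟩ => ⟨z, ζ, hST hζ, h⟩⟩
    · rintro S T ⟨ε, hε, hS⟩ ⟨ε', hε', hT⟩
      refine ⟨min ε ε', lt_min hε hε', (hS.or hT).mono ?_⟩
      rintro n m x a - - ⟨z, ζ, hζ, h, ρ, hρ, hρε, hle⟩
      exact hζ.imp (fun hζ => ⟨z, ζ, hζ, h, ρ, hρ, hρε.trans (min_le_left _ _), hle⟩)
        (fun hζ => ⟨z, ζ, hζ, h, ρ, hρ, hρε.trans (min_le_right _ _), hle⟩)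
    · intro ζ₀ hζ₀
      obtain ⟨ε, hε, hpos⟩ := exists_pop_nearBound_pos hβ (ne_zero_of_norm_eq_one norm_e₀)
        (ne_zero_of_norm_eq_one (by simpa using hζ₀) : ζ₀ ≠ 0)
      obtain ⟨L, hL⟩ := quadLip_nearBound β ε
      obtain ⟨U, hU, hR⟩ := exists_nhds_rare_sum_nonpos hL hpos
      refine ⟨U, mem_nhdsWithin_of_mem_nhds hU, ε, hε, hR.mono ?_⟩
      rintro n m x a - - ⟨z, ζ, hζ, h, ρ, hρ, hρε, hle⟩
      refine ⟨z, ζ, hζ, h, ?_⟩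
      by_contra! hcon
      have h1 : ρ ^ 2 * ∑ i, nearBound β ε (inner ℝ (a i) z) (inner ℝ (a i) x) ≤ 0 := by
        refine le_trans ?_ hle
        rw [Finset.mul_sum]
        exact Finset.sum_le_sum fun i _ => nearBound_le hβ hβ' hρ hρε _ _
      exact h1.not_gt (by positivity)
  obtain ⟨ε, hε, hR⟩ := key
  refine ⟨ε, hε, hR.mono ?_⟩
  rintro n m x a - hx ⟨z, hzx, hzε, hle⟩
  have hρ : 0 < ‖z - x‖ := norm_pos_iff.2 (sub_ne_zero.2 hzx)
  set y := ‖z - x‖⁻¹ • (z - x) with hy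
  obtain ⟨ζ, hζ⟩ := exists_sameGram y x hx
  refine ⟨y, ζ, ?_, hζ, ‖z - x‖, hρ, hzε, hle.trans' (le_of_eq ?_)⟩
  · rw [mem_sphere_zero_iff_norm, ← hζ.norm_left, hy, norm_smul, norm_inv, norm_norm,
      inv_mul_cancel₀ hρ.ne']
  · refine Finset.sum_congr rfl fun i _ => ?_
    have e : ‖z - x‖ * inner ℝ (a i) y = inner ℝ (a i) z - inner ℝ (a i) x := by
      rw [hy, inner_smul_right, mul_inv_cancel_left₀ hρ.ne', inner_sub_right]
    rw [e, add_sub_cancel]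

/-- The failure of the criterion of `noSpuriousMinima_of_sums` at a vector `z`. -/
def Stuck (β : ℝ) {n m : ℕ} (x : EuclideanSpace ℝ (Fin n)) (a : Fin m → EuclideanSpace ℝ (Fin n))
    (z : EuclideanSpace ℝ (Fin n)) : Prop :=
  ∑ i, slope β (inner ℝ (a i) z) (inner ℝ (a i) x) * inner ℝ (a i) z = 0 ∧
  ∑ i, slope β (inner ℝ (a i) z) (inner ℝ (a i) x) * inner ℝ (a i) x = 0 ∧
  ∀ k, 0 ≤ ∑ i, curvBound β k (inner ℝ (a i) z) (inner ℝ (a i) x)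

/-- At each point of `K` one expected alternative is strict; by continuity and concentration it
passes to samples over a whole neighbourhood. -/
lemma rare_stuck_of_isCompact (hβ : 0 < β) (hβ' : β ≤ 1 / 2)
    {K : Set (EuclideanSpace ℝ (Fin 2))} (hK : IsCompact K) (h1 : e₀ ∉ K) (h2 : -e₀ ∉ K) :
    Rare fun _ _ x a => ∃ z, ∃ ζ ∈ K, SameGram z x ζ e₀ ∧ Stuck β x a z := by
  refine rare_of_isCompact hK (Q := fun _ _ x a z => Stuck β x a z) fun ζ₀ hζ₀ => ?_
  have hne : ∀ {L : ℝ} {Φ : ℝ → ℝ → ℝ}, QuadLip L Φ → pop Φ ζ₀ e₀ ≠ 0 → ∃ U ∈ 𝓝 ζ₀,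
      Rare fun _ _ x a => ∃ z, ∃ ζ ∈ U, SameGram z x ζ e₀ ∧
        ∑ i, Φ (inner ℝ (a i) z) (inner ℝ (a i) x) = 0 := by
    intro L Φ hΦ hpop
    rcases lt_or_gt_of_ne hpop with h | h
    · obtain ⟨U, hU, hR⟩ := exists_nhds_rare_sum_nonpos (hΦ.const_mul (-1)) (ζ₀ := ζ₀) (by
        rw [pop, integral_const_mul]
        rw [pop] at h
        linarith)
      refine ⟨U, hU, hR.mono ?_⟩
      rintro n m x a - - ⟨z, ζ, hζ, hg, hs⟩
      exact ⟨z, ζ, hζ, hg, by rw [← Finset.mul_sum, hs, mul_zero]⟩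
    · obtain ⟨U, hU, hR⟩ := exists_nhds_rare_sum_nonpos hΦ h
      exact ⟨U, hU, hR.mono fun n m x a _ _ ⟨z, ζ, hζ, hg, hs⟩ => ⟨z, ζ, hζ, hg, hs.le⟩⟩
  rcases pop_alternative hβ hβ' (z := ζ₀) norm_e₀ (fun h => h1 (h ▸ hζ₀)) (fun h => h2 (h ▸ hζ₀))
    with h | h | ⟨k, h⟩
  · obtain ⟨U, hU, hR⟩ := hne (quadLip_slope_mul_fst hβ) h
    exact ⟨U, hU, hR.mono fun n m x a _ _ ⟨z, ζ, hζ, hg, hs⟩ => ⟨z, ζ, hζ, hg, hs.1⟩⟩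
  · obtain ⟨U, hU, hR⟩ := hne (quadLip_slope_mul_snd hβ) h
    exact ⟨U, hU, hR.mono fun n m x a _ _ ⟨z, ζ, hζ, hg, hs⟩ => ⟨z, ζ, hζ, hg, hs.2.1⟩⟩
  · obtain ⟨L, hL⟩ := quadLip_curvBound β k
    obtain ⟨U, hU, hR⟩ := exists_nhds_rare_sum_nonpos (hL.const_mul (-1)) (ζ₀ := ζ₀) (by
      rw [pop, integral_const_mul]
      rw [pop] at h
      linarith)
    refine ⟨U, hU, hR.mono ?_⟩
    rintro n m x a - - ⟨z, ζ, hζ, hg, hs⟩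
    exact ⟨z, ζ, hζ, hg, by rw [← Finset.mul_sum]; linarith [hs.2.2 k]⟩

lemma Stuck.neg (hβ : 0 < β) {n m : ℕ} {x : EuclideanSpace ℝ (Fin n)}
    {a : Fin m → EuclideanSpace ℝ (Fin n)} {z : EuclideanSpace ℝ (Fin n)} (h : Stuck β x a z) :
    Stuck β x a (-z) := by
  obtain ⟨h1, h2, h3⟩ := h
  refine ⟨?_, ?_, fun k => ?_⟩
  · simpa [slope_neg hβ] using h1
  · simpa [slope_neg hβ] using h2
  · simpa [curvBound] using h3 k

/-- Three regions cover everything: norm at least 2, the punctured `ε`-balls about `±x` (exchanged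
by `z ↦ -z`), and the rest, whose Gram data form a compact set avoiding `±e₀`. -/
theorem rare_stuck (hβ : 0 < β) (hβ' : β ≤ 1 / 2) :
    Rare fun _ _ x a => ∃ z, z ≠ x ∧ z ≠ -x ∧ Stuck β x a z := by
  obtain ⟨ε, hε, hnear⟩ := exists_rare_near hβ hβ'
  set K : Set (EuclideanSpace ℝ (Fin 2)) :=
    Metric.closedBall 0 2 ∩ ({ζ | ε ≤ ‖ζ - e₀‖} ∩ {ζ | ε ≤ ‖ζ + e₀‖}) with hK
  have hKc : IsCompact K := (isCompact_closedBall _ _).inter_right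
    ((isClosed_le (by fun_prop) (by fun_prop)).inter (isClosed_le (by fun_prop) (by fun_prop)))
  have hmid := rare_stuck_of_isCompact hβ hβ' hKc
    (fun h => by have : ε ≤ ‖e₀ - e₀‖ := h.2.1
                 simp at this; linarith)
    (fun h => by have : ε ≤ ‖-e₀ + e₀‖ := h.2.2
                 simp at this; linarith)
  refine ((hnear.or (rare_radial_nonpos hβ hβ')).or hmid).mono ?_
  rintro n m x a - hx ⟨z, hz1, hz2, hs⟩
  have near : ∀ w, w ≠ x → ‖w - x‖ ≤ ε → Stuck β x a w → ∃ z, z ≠ x ∧ ‖z - x‖ ≤ ε ∧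
      ∑ i, slope β (inner ℝ (a i) z) (inner ℝ (a i) x) *
      (inner ℝ (a i) z - inner ℝ (a i) x) ≤ 0 := by
    intro w hw hwε hsw
    refine ⟨w, hw, hwε, le_of_eq ?_⟩
    simp only [mul_sub, Finset.sum_sub_distrib, hsw.1, hsw.2.1, sub_zero]
  rcases le_total 2 ‖z‖ with h | h
  · exact Or.inl (Or.inr ⟨z, h, hs.1.le⟩)
  rcases le_total ‖z - x‖ ε with h3 | h3
  · exact Or.inl (Or.inl (near z hz1 h3 hs))
  rcases le_total ‖z + x‖ ε with h4 | h4
  · refine Or.inl (Or.inl (near (-z) (fun h => hz2 (by rw [← h, neg_neg])) ?_ (hs.neg hβ)))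
    rwa [← neg_add', norm_neg]
  obtain ⟨ζ, hζ⟩ := exists_sameGram z x hx
  refine Or.inr ⟨z, ζ, ⟨?_, ?_, ?_⟩, hζ, hs⟩
  · rwa [mem_closedBall_zero_iff, ← hζ.norm_left]
  · have := hζ.norm_comb 1 (-1)
    simp only [one_smul, neg_smul, ← sub_eq_add_neg] at this
    change ε ≤ ‖ζ - e₀‖
    rwa [← this]
  · have := hζ.norm_comb 1 1
    simp only [one_smul] at this
    change ε ≤ ‖ζ + e₀‖
    rwa [← this]

/-! ### Rescaling to arbitrary targets and the final statement -/

theorem rare_not_noSpuriousMinima (hβ : 0 < β) (hβ' : β ≤ 1 / 2) :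
    ∃ C c δ : ℝ, 0 < C ∧ 0 < c ∧ 0 < δ ∧ ∀ n m : ℕ, C * n ≤ m →
      ∀ x : EuclideanSpace ℝ (Fin n), x ≠ 0 →
        gaussianSample n m {a | ¬ NoSpuriousMinima (loss β a x) x} ≤
          ENNReal.ofReal (c * Real.exp (-δ * m)) := by
  obtain ⟨C, c, δ, hC, hc, hδ, hR⟩ := rare_forall_inner_eq_zero.or (rare_stuck hβ hβ')
  refine ⟨C, c, δ, hC, hc, hδ, fun n m hnm x hx => ?_⟩
  -- A nonzero `x` forces `n > 0`, hence `m > 0`, which `Rare` requires.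
  have hn : 0 < n := by
    rcases Nat.eq_zero_or_pos n with rfl | h
    · exact absurd (Subsingleton.elim x 0) hx
    · exact h
  have hm : 0 < m := by
    have : (0 : ℝ) < C * n := by positivity
    exact_mod_cast this.trans_le hnm
  have hx' := norm_pos_iff.2 hx
  set y := ‖x‖⁻¹ • x with hy
  have hyn : ‖y‖ = 1 := by rw [hy, norm_smul, norm_inv, norm_norm, inv_mul_cancel₀ hx'.ne']
  have hxy : x = ‖x‖ • y := by rw [hy, smul_inv_smul₀ hx'.ne']
  refine (measure_mono fun a ha => ?_).trans (hR n m hm hnm y hyn)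
  by_contra hgood
  simp only [Set.mem_ofPred_eq, not_or] at hgood
  obtain ⟨h1, h2⟩ := hgood
  have hix : ∀ i, inner ℝ (a i) x = ‖x‖ * inner ℝ (a i) y := fun i => by
    conv_lhs => rw [hxy]
    rw [inner_smul_right]
  refine ha (noSpuriousMinima_of_sums hβ hβ' hx (fun z hz => ?_) fun z hz1 hz2 => ?_)
  · push Not at h1
    obtain ⟨i, hi1, hi2⟩ := h1 z hz
    exact ⟨i, hi1, by rw [hix]; exact mul_ne_zero hx'.ne' hi2⟩
  · set w := ‖x‖⁻¹ • z with hw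
    have hzw : z = ‖x‖ • w := by rw [hw, smul_inv_smul₀ hx'.ne']
    have hiz : ∀ i, inner ℝ (a i) z = ‖x‖ * inner ℝ (a i) w := fun i => by
      conv_lhs => rw [hzw]
      rw [inner_smul_right]
    by_contra! hcon
    obtain ⟨c1, c2, c3⟩ := hcon
    refine h2 ⟨w, ?_, ?_, ?_, ?_, ?_⟩
    · intro h; exact hz1 (by rw [hzw, h, ← hxy])
    · intro h; exact hz2 (by rw [hzw, h, smul_neg, ← hxy])
    · simp only [hix, hiz, slope_smul hx', mul_mul_mul_comm ‖x‖, ← Finset.mul_sum] at c1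
      exact (mul_eq_zero.1 c1).resolve_left (by positivity)
    · simp only [hix, hiz, slope_smul hx', mul_mul_mul_comm ‖x‖, ← Finset.mul_sum] at c2
      exact (mul_eq_zero.1 c2).resolve_left (by positivity)
    · intro k
      have := c3 k
      simp only [hix, hiz, curvBound_smul, ← Finset.mul_sum] at this
      exact nonneg_of_mul_nonneg_right this (by positivity)

end SAF

theorem theorem1p1 (β : ℝ) (hβ : 0 < β) (hβ' : β ≤ 1 / 2) :
    ∃ C c δ : ℝ, 0 < C ∧ 0 < c ∧ 0 < δ ∧
      ∀ (n m : ℕ), C * (n : ℝ) ≤ (m : ℝ) →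
      ∀ (x : EuclideanSpace ℝ (Fin n)), x ≠ 0 →
      ∀ {Ω : Type*} [MeasurableSpace Ω] (P : Measure Ω) [IsProbabilityMeasure P]
        (a : Fin m → Ω → EuclideanSpace ℝ (Fin n)),
        iIndepFun a P →
        (∀ i, HasLaw (a i) (stdGaussian (EuclideanSpace ℝ (Fin n))) P) →
        ∃ A : Set Ω, MeasurableSet A ∧ 1 - c * Real.exp (-δ * (m : ℝ)) ≤ P.real A ∧
          ∀ ω ∈ A, SAF.NoSpuriousMinima (SAF.loss β (fun i => a i ω) x) x := by
  obtain ⟨C, c, δ, hC, hc, hδ, h⟩ := SAF.rare_not_noSpuriousMinima hβ hβ'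
  refine ⟨C, c, δ, hC, hc, hδ, fun n m hnm x hx Ω _ P _ a hind hlaw => ?_⟩
  have hmeas : ∀ i, AEMeasurable (a i) P := fun i => (hlaw i).aemeasurable
  have hmap : P.map (fun ω i => a i ω) = SAF.gaussianSample n m := by
    rw [(iIndepFun_iff_map_fun_eq_pi_map hmeas).1 hind]
    simp only [(hlaw _).map_eq]
  set N : Set Ω := {ω | ¬ SAF.NoSpuriousMinima (SAF.loss β (fun i => a i ω) x) x} with hN
  have hPN : P N ≤ ENNReal.ofReal (c * Real.exp (-δ * m)) := by
    refine le_trans ?_ (h n m hnm x hx)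
    rw [← hmap]
    exact Measure.le_map_apply (aemeasurable_pi_lambda _ hmeas)
      {b | ¬ SAF.NoSpuriousMinima (SAF.loss β b x) x}
  -- Measurability of the failure set `N` is never established; a measurable hull of the same
  -- measure replaces it.
  refine ⟨(toMeasurable P N)ᶜ, (measurableSet_toMeasurable P N).compl, ?_, fun ω hω => ?_⟩
  · rw [probReal_compl_eq_one_sub (measurableSet_toMeasurable P N)]
    have : P.real (toMeasurable P N) ≤ c * Real.exp (-δ * m) := by
      rw [measureReal_def, measure_toMeasurable]
      exact ENNReal.toReal_le_of_le_ofReal (by positivity) hPN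
    linarith
  · by_contra hcon
    exact hω (subset_toMeasurable P N hcon)
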